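/- Let $\dot L^2_{\rm per}$ be the space of complex-valued, $2\pi$-periodic, locally square-integrable functions $v$ with $\int_{-\pi}^{\pi}v\,dz=0$, with the norm of $L^2(-\pi,\pi)$, and for $v\in\dot L^2_{\rm per}$ let $\partial_z^{-1}v$ be its $2\pi$-periodic antiderivative with zero mean. Let $$c_*=\frac{\pi^2}{8},\qquad U_*(z)=\frac{1}{\sqrt2}\left(|z|-\frac{\pi}{2}\right)\quad\text{for } z\in[-\pi,\pi],$$ with $U_*$ continued $2\pi$-periodically; this is the profile of the peaked travelling wave $u(x,t)=U_*(x-c_*t)$ of the reduced modified Ostrovsky equation $u_t+u^2u_x=\partial_x^{-1}u$. Consider the linearized operator $A:\operatorname{dom}(A)\subset\dot L^2_{\rm per}\to\dot L^2_{\rm per}$, $$Av=\partial_z\big[(c_*-U_*^2)\,v\big]+\partial_z^{-1}v,\qquad \operatorname{dom}(A)=\big\{v\in\dot L^2_{\rm per}:\ \partial_z\big[(c_*-U_*^2)\,v\big]\in\dot L^2_{\rm per}\big\},$$ where $\partial_z$ is the weak derivative of periodic functions. Let $\sigma(A)=\mathbb C\setminus\rho(A)$, where the resolvent set $\rho(A)$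 consists of all $\lambda\in\mathbb C$ for which $\ker(A-\lambda I)=\{0\}$, $\operatorname{ran}(A-\lambda I)=\dot L^2_{\rm per}$ and $(A-\lambda I)^{-1}:\dot L^2_{\rm per}\to\dot L^2_{\rm per}$ is bounded. Then $$\sigma(A)=\left\{\lambda\in\mathbb C:\ -\frac{\pi}{4}\le \operatorname{Re}(\lambda)\le\frac{\pi}{4}\right\}.$$ Consequently, the peaked wave $U_*$ is spectrally unstable in the reduced modified Ostrovsky equation, that is, $\sigma(A)\not\subset i\mathbb R$. -/

import Mathlib

noncomputable section

namespace Ostrovsky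

open MeasureTheory Set Real

/-- Complex-valued `2π`-periodic `L²` functions, each identified with its restriction to one
period `(-π, π]`. -/
abbrev L2per : Type := Lp ℂ 2 (volume.restrict (Ioc (-π) π))

lemma neg_pi_le_pi : -π ≤ π := by linarith [pi_pos]

lemma integrableOn_L2per (v : L2per) : IntegrableOn (v : ℝ → ℂ) (Ioc (-π) π) :=
  (Lp.memLp v).integrable (by norm_num)

lemma intervalIntegrable_L2per (v : L2per) : IntervalIntegrable (v : ℝ → ℂ) volume (-π) π :=
  (intervalIntegrable_iff_integrableOn_Ioc_of_le neg_pi_le_pi).2 (integrableOn_L2per v)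

lemma intervalIntegrable_L2per_of_mem (v : L2per) {z : ℝ} (hz : z ∈ Icc (-π) π) :
    IntervalIntegrable (v : ℝ → ℂ) volume (-π) z :=
  (intervalIntegrable_L2per v).mono_set (by
    rw [uIcc_of_le hz.1, uIcc_of_le neg_pi_le_pi]
    exact Icc_subset_Icc_right hz.2)

/-- Integrals over initial segments of the period only depend on the `L²` class. -/
lemma integral_congr_of_ae {f g : ℝ → ℂ} (h : f =ᵐ[volume.restrict (Ioc (-π) π)] g)
    {z : ℝ} (hz : z ∈ Icc (-π) π) : ∫ t in (-π)..z, f t = ∫ t in (-π)..z, g t := by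
  rw [intervalIntegral.integral_of_le hz.1, intervalIntegral.integral_of_le hz.1]
  exact integral_congr_ae (ae_restrict_of_ae_restrict_of_subset (Ioc_subset_Ioc_right hz.2) h)

lemma integral_add_L2per (v w : L2per) {z : ℝ} (hz : z ∈ Icc (-π) π) :
    ∫ t in (-π)..z, (v + w : L2per) t = (∫ t in (-π)..z, v t) + ∫ t in (-π)..z, w t := by
  rw [integral_congr_of_ae (Lp.coeFn_add v w) hz]
  exact intervalIntegral.integral_add (intervalIntegrable_L2per_of_mem v hz)
    (intervalIntegrable_L2per_of_mem w hz)

lemma integral_smul_L2per (a : ℂ) (v : L2per) {z : ℝ} (hz : z ∈ Icc (-π) π) :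
    ∫ t in (-π)..z, (a • v : L2per) t = a * ∫ t in (-π)..z, v t := by
  rw [integral_congr_of_ae (Lp.coeFn_smul a v) hz]
  simp

/-- The space of mean-zero `2π`-periodic `L²` functions, with the `L²` norm. -/
def dotL2per : Submodule ℂ L2per where
  carrier := {v | ∫ z in (-π)..π, v z = 0}
  zero_mem' := by
    have h := integral_smul_L2per 0 0 (right_mem_Icc.2 neg_pi_le_pi)
    simpa using h
  add_mem' := by
    intro v w hv hw
    have h := integral_add_L2per v w (right_mem_Icc.2 neg_pi_le_pi)
    simp only [mem_ofPred_eq] at *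
    rw [h, hv, hw, add_zero]
  smul_mem' := by
    intro a v hv
    have h := integral_smul_L2per a v (right_mem_Icc.2 neg_pi_le_pi)
    simp only [mem_ofPred_eq] at *
    rw [h, hv, mul_zero]

/-- `g` is the weak derivative `∂_z f` of the `2π`-periodic function `f`: both are integrable over
a period and `∫ f φ' = - ∫ g φ` for all smooth `2π`-periodic test functions `φ`. -/
def HasWeakDeriv (f g : ℝ → ℂ) : Prop :=
  IntegrableOn f (Ioc (-π) π) ∧ IntegrableOn g (Ioc (-π) π) ∧
    ∀ φ : ℝ → ℂ, ContDiff ℝ (⊤ : ℕ∞) φ → Function.Periodic φ (2 * π) →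
      ∫ z in (-π)..π, f z * deriv φ z = -∫ z in (-π)..π, g z * φ z

lemma intervalIntegrable_mul_of_continuous {f φ : ℝ → ℂ} (hf : IntegrableOn f (Ioc (-π) π))
    (hφ : Continuous φ) : IntervalIntegrable (fun z => f z * φ z) volume (-π) π :=
  ((intervalIntegrable_iff_integrableOn_Ioc_of_le neg_pi_le_pi).2 hf).mul_continuousOn
    hφ.continuousOn

lemma HasWeakDeriv.add {f₁ f₂ g₁ g₂ : ℝ → ℂ} (h₁ : HasWeakDeriv f₁ g₁)
    (h₂ : HasWeakDeriv f₂ g₂) :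
    HasWeakDeriv (fun z => f₁ z + f₂ z) (fun z => g₁ z + g₂ z) := by
  refine ⟨h₁.1.add h₂.1, h₁.2.1.add h₂.2.1, fun φ hφ hp => ?_⟩
  have hφ' : Continuous (deriv φ) := hφ.continuous_deriv (by simp)
  simp only [add_mul]
  rw [intervalIntegral.integral_add (intervalIntegrable_mul_of_continuous h₁.1 hφ')
      (intervalIntegrable_mul_of_continuous h₂.1 hφ'),
    intervalIntegral.integral_add (intervalIntegrable_mul_of_continuous h₁.2.1 hφ.continuous)
      (intervalIntegrable_mul_of_continuous h₂.2.1 hφ.continuous),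
    h₁.2.2 φ hφ hp, h₂.2.2 φ hφ hp]
  ring

lemma HasWeakDeriv.const_mul {f g : ℝ → ℂ} (a : ℂ) (h : HasWeakDeriv f g) :
    HasWeakDeriv (fun z => a * f z) (fun z => a * g z) := by
  refine ⟨h.1.const_mul a, h.2.1.const_mul a, fun φ hφ hp => ?_⟩
  simp only [mul_assoc]
  rw [intervalIntegral.integral_const_mul, intervalIntegral.integral_const_mul, h.2.2 φ hφ hp]
  ring

lemma HasWeakDeriv.congr {f₁ f₂ g₁ g₂ : ℝ → ℂ} (h : HasWeakDeriv f₁ g₁)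
    (hf : f₁ =ᵐ[volume.restrict (Ioc (-π) π)] f₂)
    (hg : g₁ =ᵐ[volume.restrict (Ioc (-π) π)] g₂) : HasWeakDeriv f₂ g₂ := by
  refine ⟨h.1.congr hf, h.2.1.congr hg, fun φ hφ hp => ?_⟩
  have e₁ : (fun z => f₁ z * deriv φ z) =ᵐ[volume.restrict (Ioc (-π) π)]
      fun z => f₂ z * deriv φ z := by
    filter_upwards [hf] with z hz
    rw [hz]
  have e₂ : (fun z => g₁ z * φ z) =ᵐ[volume.restrict (Ioc (-π) π)] fun z => g₂ z * φ z := by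
    filter_upwards [hg] with z hz
    rw [hz]
  rw [← integral_congr_of_ae e₁ (right_mem_Icc.2 neg_pi_le_pi),
    ← integral_congr_of_ae e₂ (right_mem_Icc.2 neg_pi_le_pi)]
  exact h.2.2 φ hφ hp

/-- A square-integrable weak derivative is unique. -/
lemma HasWeakDeriv.unique {f : ℝ → ℂ} {g₁ g₂ : L2per} (h₁ : HasWeakDeriv f g₁)
    (h₂ : HasWeakDeriv f g₂) : g₁ = g₂ := by
  have hlt : -π < π := by linarith [pi_pos]
  have hint : ∀ φ : ℝ → ℂ, ContDiff ℝ (⊤ : ℕ∞) φ → Function.Periodic φ (2 * π) →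
      ∫ z in (-π)..π, φ z * (g₁ z - g₂ z) = 0 := by
    intro φ hφ hp
    have e : ∀ z, φ z * (g₁ z - g₂ z) = g₁ z * φ z - g₂ z * φ z := fun z => by ring
    simp only [e]
    rw [intervalIntegral.integral_sub
        (intervalIntegrable_mul_of_continuous h₁.2.1 hφ.continuous)
        (intervalIntegrable_mul_of_continuous h₂.2.1 hφ.continuous)]
    have a₁ := h₁.2.2 φ hφ hp
    have a₂ := h₂.2.2 φ hφ hp
    rw [a₁] at a₂
    rw [neg_inj.1 a₂, sub_self]
  have hmem : MemLp (fun z => g₁ z - g₂ z) 2 (volume.restrict (Ioc (-π) π)) :=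
    (Lp.memLp g₁).sub (Lp.memLp g₂)
  have hcoef : ∀ n : ℤ, fourierCoeffOn hlt (fun z => g₁ z - g₂ z) n = 0 := by
    intro n
    rw [fourierCoeffOn_eq_integral]
    simp only [smul_eq_mul]
    rw [hint, smul_zero]
    · simp only [fourier_coe_apply]
      have h : ContDiff ℝ (⊤ : ℕ∞) (fun x : ℝ => (x : ℂ)) := Complex.ofRealCLM.contDiff
      exact ((contDiff_const.mul h).div_const _).cexp
    · intro z
      have : ((z + 2 * π : ℝ) : AddCircle (π - -π)) = (z : AddCircle (π - -π)) := by
        have e : 2 * π = π - -π := by ring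
        rw [e]
        exact AddCircle.coe_add_period _ z
      simp only [this]
  have hsum := hasSum_sq_fourierCoeffOn hlt hmem
  simp only [hcoef, norm_zero, ne_eq, OfNat.ofNat_ne_zero, not_false_eq_true, zero_pow] at hsum
  have hz := hsum.unique hasSum_zero
  have hz' : ∫ z in Ioc (-π) π, ‖g₁ z - g₂ z‖ ^ 2 = 0 := by
    rw [← intervalIntegral.integral_of_le neg_pi_le_pi]
    rcases smul_eq_zero.1 hz with h | h
    · exact absurd h (inv_ne_zero (by linarith))
    · exact h
  have hsq : Integrable (fun z => ‖g₁ z - g₂ z‖ ^ 2) (volume.restrict (Ioc (-π) π)) :=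
    hmem.integrable_norm_pow (by norm_num)
  have hae := (integral_eq_zero_iff_of_nonneg (fun z => by positivity) hsq).1 hz'
  apply Lp.ext
  filter_upwards [hae] with z hz
  have : ‖g₁ z - g₂ z‖ = 0 := by simpa using hz
  exact sub_eq_zero.1 (norm_eq_zero.1 this)

/-- The mean-zero antiderivative of `v` on the period `[-π, π]`. -/
def antideriv (v : ℝ → ℂ) (z : ℝ) : ℂ :=
  (∫ t in (-π)..z, v t) - (1 / (2 * π) : ℝ) * ∫ s in (-π)..π, ∫ t in (-π)..s, v t

lemma continuousOn_primitive (v : L2per) :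
    ContinuousOn (fun z => ∫ t in (-π)..z, v t) (Icc (-π) π) := by
  have h : IntegrableOn (v : ℝ → ℂ) (uIcc (-π) π) := by
    rw [uIcc_of_le neg_pi_le_pi, integrableOn_Icc_iff_integrableOn_Ioc]
    exact integrableOn_L2per v
  simpa [uIcc_of_le neg_pi_le_pi] using
    intervalIntegral.continuousOn_primitive_interval h

lemma intervalIntegrable_primitive (v : L2per) :
    IntervalIntegrable (fun z => ∫ t in (-π)..z, v t) volume (-π) π :=
  ContinuousOn.intervalIntegrable (by
    rw [uIcc_of_le neg_pi_le_pi]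
    exact continuousOn_primitive v)

lemma memLp_antideriv (v : L2per) :
    MemLp (antideriv v) 2 (volume.restrict (Ioc (-π) π)) := by
  have hc : ContinuousOn (antideriv v) (Icc (-π) π) :=
    (continuousOn_primitive v).sub continuousOn_const
  obtain ⟨C, hC⟩ := isCompact_Icc.exists_bound_of_continuousOn hc
  refine MemLp.of_bound
    ((hc.mono Ioc_subset_Icc_self).aestronglyMeasurable measurableSet_Ioc) C ?_
  filter_upwards [ae_restrict_mem measurableSet_Ioc] with z hz
  exact hC z (Ioc_subset_Icc_self hz)

lemma integral_antideriv (v : L2per) : ∫ z in (-π)..π, antideriv v z = 0 := by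
  unfold antideriv
  rw [intervalIntegral.integral_sub (intervalIntegrable_primitive v) (by simp),
    intervalIntegral.integral_const, Complex.real_smul, ← mul_assoc, ← Complex.ofReal_mul]
  have : (π - -π) * (1 / (2 * π)) = 1 := by
    have := pi_pos.ne'
    field_simp
    ring
  rw [this]
  simp

lemma antideriv_add (v w : L2per) {z : ℝ} (hz : z ∈ Icc (-π) π) :
    antideriv (v + w : L2per) z = antideriv v z + antideriv w z := by
  have e : ∫ s in (-π)..π, ∫ t in (-π)..s, (v + w : L2per) t =
      ∫ s in (-π)..π, ((∫ t in (-π)..s, v t) + ∫ t in (-π)..s, w t) := by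
    apply intervalIntegral.integral_congr
    intro s hs
    rw [uIcc_of_le neg_pi_le_pi] at hs
    exact integral_add_L2per v w hs
  unfold antideriv
  rw [e, integral_add_L2per v w hz, intervalIntegral.integral_add
    (intervalIntegrable_primitive v) (intervalIntegrable_primitive w)]
  ring

lemma antideriv_smul (a : ℂ) (v : L2per) {z : ℝ} (hz : z ∈ Icc (-π) π) :
    antideriv (a • v : L2per) z = a * antideriv v z := by
  have e : ∫ s in (-π)..π, ∫ t in (-π)..s, (a • v : L2per) t =
      ∫ s in (-π)..π, a * ∫ t in (-π)..s, v t := by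
    apply intervalIntegral.integral_congr
    intro s hs
    rw [uIcc_of_le neg_pi_le_pi] at hs
    exact integral_smul_L2per a v hs
  unfold antideriv
  rw [e, integral_smul_L2per a v hz, intervalIntegral.integral_const_mul]
  ring

/-- The operator `∂_z⁻¹` on mean-zero periodic `L²` functions. -/
def invDeriv : dotL2per →ₗ[ℂ] dotL2per where
  toFun v := ⟨(memLp_antideriv v).toLp (antideriv v), by
    have h := integral_congr_of_ae (memLp_antideriv v).coeFn_toLp (right_mem_Icc.2 neg_pi_le_pi)
    exact h.trans (integral_antideriv v)⟩
  map_add' v w := by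
    apply Subtype.ext
    apply Lp.ext
    filter_upwards [(memLp_antideriv (v + w : L2per)).coeFn_toLp, (memLp_antideriv v).coeFn_toLp,
      (memLp_antideriv w).coeFn_toLp, ae_restrict_mem measurableSet_Ioc,
      Lp.coeFn_add ((memLp_antideriv v).toLp (antideriv v))
        ((memLp_antideriv w).toLp (antideriv w))] with z h₁ h₂ h₃ hz h₄
    simp only [Submodule.coe_add] at *
    rw [h₁, h₄, Pi.add_apply, h₂, h₃, antideriv_add _ _ (Ioc_subset_Icc_self hz)]
  map_smul' a v := by
    apply Subtype.ext
    apply Lp.ext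
    filter_upwards [(memLp_antideriv (a • v : L2per)).coeFn_toLp, (memLp_antideriv v).coeFn_toLp,
      ae_restrict_mem measurableSet_Ioc,
      Lp.coeFn_smul a ((memLp_antideriv v).toLp (antideriv v))] with z h₁ h₂ hz h₄
    simp only [Submodule.coe_smul, RingHom.id_apply] at *
    rw [h₁, h₄, Pi.smul_apply, h₂, antideriv_smul _ _ (Ioc_subset_Icc_self hz), smul_eq_mul]

/-- The product `(c - U(z)^p) v(z)`. -/
def flux (p : ℕ) (c : ℝ) (U : ℝ → ℝ) (v : ℝ → ℂ) (z : ℝ) : ℂ := ((c - U z ^ p : ℝ) : ℂ) * v z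

lemma hasWeakDeriv_flux_add (p : ℕ) (c : ℝ) (U : ℝ → ℝ) {v w g h : dotL2per}
    (hv : HasWeakDeriv (flux p c U v) g) (hw : HasWeakDeriv (flux p c U w) h) :
    HasWeakDeriv (flux p c U (v + w : dotL2per)) (g + h : dotL2per) := by
  refine (hv.add hw).congr ?_ (Lp.coeFn_add (g : L2per) h).symm
  filter_upwards [Lp.coeFn_add (v : L2per) w] with z hz
  simp only [flux, Submodule.coe_add]
  rw [hz, Pi.add_apply]
  ring

lemma hasWeakDeriv_flux_smul (p : ℕ) (c : ℝ) (U : ℝ → ℝ) (a : ℂ) {v g : dotL2per}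
    (hv : HasWeakDeriv (flux p c U v) g) :
    HasWeakDeriv (flux p c U (a • v : dotL2per)) (a • g : dotL2per) := by
  refine (hv.const_mul a).congr ?_ (Lp.coeFn_smul a (g : L2per)).symm
  filter_upwards [Lp.coeFn_smul a (v : L2per)] with z hz
  simp only [flux, Submodule.coe_smul]
  rw [hz, Pi.smul_apply, smul_eq_mul]
  ring

/-- The maximal domain: all mean-zero `v ∈ L²` with `∂_z[(c - U^p) v]` in the mean-zero `L²`
space. -/
def maxDomain (p : ℕ) (c : ℝ) (U : ℝ → ℝ) : Submodule ℂ dotL2per where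
  carrier := {v | ∃ g : dotL2per, HasWeakDeriv (flux p c U v) g}
  zero_mem' := ⟨0, by
    refine HasWeakDeriv.congr (f₁ := fun _ => 0) (g₁ := fun _ => 0)
      ⟨integrableOn_zero, integrableOn_zero, by simp⟩ ?_ (Lp.coeFn_zero _ _ _).symm
    filter_upwards [Lp.coeFn_zero ℂ 2 (volume.restrict (Ioc (-π) π))] with z hz
    simp only [flux, Submodule.coe_zero]
    rw [hz]
    simp⟩
  add_mem' := by
    rintro v w ⟨g, hg⟩ ⟨h, hh⟩
    exact ⟨g + h, hasWeakDeriv_flux_add p c U hg hh⟩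
  smul_mem' := by
    rintro a v ⟨g, hg⟩
    exact ⟨a • g, hasWeakDeriv_flux_smul p c U a hg⟩

/-- `∂_z[(c - U^p) v]` for `v` in the maximal domain. -/
def fluxDeriv (p : ℕ) (c : ℝ) (U : ℝ → ℝ) (v : maxDomain p c U) : dotL2per := v.2.choose

lemma fluxDeriv_spec (p : ℕ) (c : ℝ) (U : ℝ → ℝ) (v : maxDomain p c U) :
    HasWeakDeriv (flux p c U (v : dotL2per)) (fluxDeriv p c U v) := v.2.choose_spec

lemma fluxDeriv_eq (p : ℕ) (c : ℝ) (U : ℝ → ℝ) (v : maxDomain p c U) {g : dotL2per}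
    (hg : HasWeakDeriv (flux p c U (v : dotL2per)) g) : fluxDeriv p c U v = g :=
  Subtype.ext ((fluxDeriv_spec p c U v).unique hg)

/-- The linearized operator `A v = ∂_z[(c - U^p) v] + ∂_z⁻¹ v` in the mean-zero periodic `L²`
space, with its maximal domain, at a `2π`-periodic travelling wave `u(x,t) = U(x - ct)` of
`u_t + u^p u_x = ∂_x⁻¹ u`. -/
def linearizedOperator (p : ℕ) (c : ℝ) (U : ℝ → ℝ) : dotL2per →ₗ.[ℂ] dotL2per where
  domain := maxDomain p c U
  toFun :=
    { toFun := fun v => fluxDeriv p c U v + invDeriv v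
      map_add' := by
        intro v w
        rw [fluxDeriv_eq p c U (v + w)
          (hasWeakDeriv_flux_add p c U (fluxDeriv_spec p c U v) (fluxDeriv_spec p c U w)),
          Submodule.coe_add, map_add]
        abel
      map_smul' := by
        intro a v
        rw [fluxDeriv_eq p c U (a • v)
          (hasWeakDeriv_flux_smul p c U a (fluxDeriv_spec p c U v)),
          Submodule.coe_smul, map_smul, RingHom.id_apply, smul_add] }

/-- The resolvent set of an unbounded operator `T` in `X`: those `z` for which `T - z` has trivial
kernel, range equal to `X`, and bounded inverse `(T - z)⁻¹ : X → X`. -/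
def resolventSet {X : Type*} [NormedAddCommGroup X] [NormedSpace ℂ X] (T : X →ₗ.[ℂ] X) : Set ℂ :=
  {z | (∀ v : T.domain, T v - z • (v : X) = 0 → v = 0) ∧
    (∀ f : X, ∃ v : T.domain, T v - z • (v : X) = f) ∧
    ∃ C : ℝ, ∀ v : T.domain, ‖(v : X)‖ ≤ C * ‖T v - z • (v : X)‖}

/-- The spectrum of an unbounded operator. -/
def spectrum {X : Type*} [NormedAddCommGroup X] [NormedSpace ℂ X] (T : X →ₗ.[ℂ] X) : Set ℂ :=
  (resolventSet T)ᶜ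

/-- Spectral stability of the travelling wave with profile `U` and speed `c`: the spectrum of the
linearized operator lies on the imaginary axis. -/
def SpectrallyStable (p : ℕ) (c : ℝ) (U : ℝ → ℝ) : Prop :=
  spectrum (linearizedOperator p c U) ⊆ {z : ℂ | z.re = 0}

/-- Spectral instability: failure of spectral stability. -/
def SpectrallyUnstable (p : ℕ) (c : ℝ) (U : ℝ → ℝ) : Prop := ¬ SpectrallyStable p c U

/-- The peaked profile `U_*(z) = (|z| - π/2)/√2` on `(-π, π]`, continued `2π`-periodically. -/
def peakedWave (z : ℝ) : ℝ := (|toIocMod two_pi_pos (-π) z| - π / 2) / √2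

lemma peakedWave_periodic : Function.Periodic peakedWave (2 * π) := by
  intro z
  simp [peakedWave]

lemma peakedWave_eq {z : ℝ} (hz : z ∈ Icc (-π) π) : peakedWave z = (|z| - π / 2) / √2 := by
  rcases hz.1.eq_or_lt with h | h
  · have : peakedWave z = peakedWave π := by
      rw [← h, ← peakedWave_periodic (-π)]
      congr 1
      ring
    rw [this, ← h, abs_neg]
    unfold peakedWave
    rw [(toIocMod_eq_self two_pi_pos).2 ⟨by linarith [pi_pos], by linarith⟩]
  · unfold peakedWave
    rw [(toIocMod_eq_self two_pi_pos).2 ⟨h, by linarith [hz.2]⟩]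

/-- The speed `c_* = π²/8` of the peaked wave. -/
def peakedSpeed : ℝ := π ^ 2 / 8

end Ostrovsky

end

/-!
Write `w = c_* - U_*²`. On each of the half-periods `(-π, 0)` and `(0, π)`, of length `π` and with
ends `a < b`, one has `w(z) = (z - a)(b - z)/2`, so `w` vanishes linearly at both ends and
`|w'| ≤ π/2`. The operator is `A = A₀ + K`, where `A₀ v = (w v)'` is a transport operator and
`K = ∂_z⁻¹` is compact and skew-adjoint.

*No boundary terms.* If `F' = f` is integrable on a half-period and `F / w` is integrable as well,
then `F` tends to `0` at both ends, because `1 / w` is not integrable there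
(`IsPrimitiveOn.integral_eq_zero`). All integrations by parts rest on this fact.

*Outside the strip.* With `F = w |v|²` it gives `2 Re ⟨v, A₀ v⟩ = ∫ w' |v|²`, hence
`|Re ⟨v, A v⟩| = |Re ⟨v, A₀ v⟩| ≤ (π/4) ‖v‖²`, so `A - λ` and `A₀ - λ` are bounded below for
`|Re λ| > π/4`. For such `λ` the equation `(w v)' - λ v = f` is solved on each half-period by
variation of constants, integrating from `b` if `Re λ > 0` and from `a` if `Re λ < 0`; a one-sided
energy estimate puts the solution in `L²` (`HasFluxDerivOn.memLp_of_bound`).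

*Inside the strip.* With `τ = ∫ dz / w`, eigenfunctions of `A₀` would be multiples of `e^{λ τ} / w`,
and these are never square integrable, so `A₀` has no eigenvalues at all. For `|Re λ| < π/4` the
adjoint solution `e^{-λ τ}` is square integrable and annihilates the range of `A₀ - λ`, which is
therefore not surjective.

*From `A₀` to `A`.* By the Fredholm alternative, if one of `A₀ - λ`, `A - λ` is boundedly invertible
and the other is injective, then the other is boundedly invertible as well
(`mem_resolventSet_of_compact_perturbation`). Going from `A₀` to `A` shows that all `λ` with
`|Re λ| > π/4` are in the resolvent set of `A`; going from `A` to `A₀` shows that none with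
`|Re λ| < π/4` are. The resolvent set is open, which settles the boundary lines.
-/

noncomputable section

namespace Ostrovsky

open MeasureTheory Set Real Filter Topology
open scoped ComplexConjugate

/-! ### Resolvents under bounded perturbations -/

section Resolvent

variable {X : Type*} [NormedAddCommGroup X] [NormedSpace ℂ X]

/-- `R` is the bounded inverse `(T - z)⁻¹` of an unbounded operator `T` shifted by `z`. -/
def IsResolvent (T : X →ₗ.[ℂ] X) (z : ℂ) (R : X →L[ℂ] X) : Prop :=
  (∀ f, ∃ h : R f ∈ T.domain, T ⟨R f, h⟩ - z • R f = f) ∧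
    ∀ v : T.domain, R (T v - z • (v : X)) = v

lemma IsResolvent.mem_resolventSet {T : X →ₗ.[ℂ] X} {z : ℂ} {R : X →L[ℂ] X}
    (h : IsResolvent T z R) : z ∈ resolventSet T := by
  refine ⟨fun v hv => ?_, fun f => ?_, ‖R‖, fun v => ?_⟩
  · have := h.2 v
    rw [hv, map_zero] at this
    exact Subtype.ext this.symm
  · obtain ⟨hd, he⟩ := h.1 f
    exact ⟨⟨R f, hd⟩, he⟩
  · conv_lhs => rw [← h.2 v]
    exact R.le_opNorm _

lemma exists_isResolvent {T : X →ₗ.[ℂ] X} {z : ℂ} (h : z ∈ resolventSet T) :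
    ∃ R : X →L[ℂ] X, IsResolvent T z R := by
  obtain ⟨hinj, hsurj, C, hC⟩ := h
  let L : T.domain →ₗ[ℂ] X := T.toFun - z • T.domain.subtype
  have hL : ∀ v : T.domain, L v = T v - z • (v : X) := fun v => rfl
  have hbij : Function.Bijective L :=
    ⟨(injective_iff_map_eq_zero L).2 fun v hv => hinj v hv, fun f => hsurj f⟩
  let e := LinearEquiv.ofBijective L hbij
  have he : ∀ v, e v = T v - z • (v : X) := fun v => hL v
  let R : X →L[ℂ] X := LinearMap.mkContinuous (T.domain.subtype ∘ₗ e.symm.toLinearMap) C (by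
    intro f
    have := hC (e.symm f)
    rw [← he, e.apply_symm_apply] at this
    exact this)
  have hR : ∀ f, R f = e.symm f := fun f => rfl
  refine ⟨R, fun f => ⟨(e.symm f).2, ?_⟩, fun v => ?_⟩
  · have := he (e.symm f)
    rw [e.apply_symm_apply] at this
    exact this.symm
  · rw [hR, ← he, e.symm_apply_apply]

/-- If `R = (T - z)⁻¹` and `S - w = (T - z) + B` with `B` bounded, then invertibility of the
bounded operator `1 + R B` makes `S - w` boundedly invertible, with inverse `(1 + R B)⁻¹ R`. -/
lemma IsResolvent.mem_resolventSet_of_perturbation {T S : X →ₗ.[ℂ] X} {z w : ℂ} {R : X →L[ℂ] X}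
    (h : IsResolvent T z R) (B : X →L[ℂ] X) (hdom : S.domain = T.domain)
    (hS : ∀ (v : X) (hT : v ∈ T.domain) (hS : v ∈ S.domain),
      S ⟨v, hS⟩ - w • v = (T ⟨v, hT⟩ - z • v) + B v)
    (hu : IsUnit (1 + R * B)) : w ∈ resolventSet S := by
  obtain ⟨Q, hQ⟩ := hu
  have hQ₁ : ∀ x, (Q⁻¹ : (X →L[ℂ] X)ˣ).1 x + R (B ((Q⁻¹ : (X →L[ℂ] X)ˣ).1 x)) = x := by
    intro x
    have := congrArg (fun L : X →L[ℂ] X => L x) Q.mul_inv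
    simpa [hQ] using this
  have hQ₂ : ∀ x, (Q⁻¹ : (X →L[ℂ] X)ˣ).1 (x + R (B x)) = x := by
    intro x
    have := congrArg (fun L : X →L[ℂ] X => L x) Q.inv_mul
    simpa [hQ] using this
  refine IsResolvent.mem_resolventSet (R := (Q⁻¹ : (X →L[ℂ] X)ˣ).1 * R) ⟨fun f => ?_, ?_⟩
  · set v := ((Q⁻¹ : (X →L[ℂ] X)ˣ).1 * R) f with hv
    have e : v = R (f - B v) := by
      have := hQ₁ (R f)
      rw [map_sub]
      exact eq_sub_of_add_eq this
    obtain ⟨hd, hf⟩ := h.1 (f - B v)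
    have hvT : v ∈ T.domain := by rw [e]; exact hd
    refine ⟨by rw [hdom]; exact hvT, ?_⟩
    rw [hS v hvT]
    have hf' : T ⟨v, hvT⟩ - z • v = f - B v := by
      convert hf using 3
      exact Subtype.ext e
    rw [hf', sub_add_cancel]
  · rintro ⟨v, hv⟩
    have hvT : v ∈ T.domain := hdom ▸ hv
    have h2 := h.2 ⟨v, hvT⟩
    change (Q⁻¹ : (X →L[ℂ] X)ˣ).1 (R (S ⟨v, hv⟩ - w • v)) = v
    rw [hS v hvT hv, map_add, h2]
    exact hQ₂ v

/-- The resolvent set is open (Neumann series). -/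
lemma isOpen_resolventSet [CompleteSpace X] (T : X →ₗ.[ℂ] X) : IsOpen (resolventSet T) := by
  rw [isOpen_iff_mem_nhds]
  intro z hz
  obtain ⟨R, hR⟩ := exists_isResolvent hz
  have hc : Continuous fun w : ℂ => 1 + R * ((z - w) • (1 : X →L[ℂ] X)) := by fun_prop
  have hopen : IsOpen {w : ℂ | IsUnit (1 + R * ((z - w) • (1 : X →L[ℂ] X)))} :=
    Units.isOpen.preimage hc
  refine mem_of_superset (hopen.mem_nhds (by simp)) fun w hw => ?_
  refine hR.mem_resolventSet_of_perturbation ((z - w) • (1 : X →L[ℂ] X)) rfl ?_ hw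
  intro v hT hS
  simp [sub_smul]

/-- A compact perturbation of a boundedly invertible operator is boundedly invertible as soon as
it is injective, by the Fredholm alternative. -/
lemma mem_resolventSet_of_compact_perturbation [CompleteSpace X] {T S : X →ₗ.[ℂ] X} {z : ℂ}
    (hz : z ∈ resolventSet T) (K : X →L[ℂ] X) (hK : IsCompactOperator K)
    (hdom : S.domain = T.domain)
    (hS : ∀ (v : X) (hT : v ∈ T.domain) (hS : v ∈ S.domain), S ⟨v, hS⟩ = T ⟨v, hT⟩ + K v)
    (hinj : ∀ v : S.domain, S v - z • (v : X) = 0 → v = 0) : z ∈ resolventSet S := by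
  obtain ⟨R, hR⟩ := exists_isResolvent hz
  have hS' : ∀ (v : X) (hT : v ∈ T.domain) (hS : v ∈ S.domain),
      S ⟨v, hS⟩ - z • v = (T ⟨v, hT⟩ - z • v) + K v := by
    intro v hvT hvS
    rw [hS v hvT hvS]
    abel
  refine hR.mem_resolventSet_of_perturbation K hdom hS' ?_
  have hRK : IsCompactOperator (R * K : X →L[ℂ] X) := hK.clm_comp R
  rcases hRK.hasEigenvalue_or_mem_resolventSet (μ := (-1 : ℂ)) (by norm_num) with h | h
  · exfalso
    obtain ⟨v, hv⟩ := h.exists_hasEigenvector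
    have e : v = R (-K v) := by
      have : R (K v) = (-1 : ℂ) • v := hv.apply_eq_smul
      rw [map_neg, this]
      simp
    obtain ⟨hd, hf⟩ := hR.1 (-K v)
    have hvT : v ∈ T.domain := by rw [e]; exact hd
    have hf' : T ⟨v, hvT⟩ - z • v = -K v := by
      convert hf using 3
      exact Subtype.ext e
    have := hinj ⟨v, hdom ▸ hvT⟩ (by rw [hS' v hvT, hf']; simp)
    exact hv.2 (congrArg Subtype.val this)
  · rw [spectrum.mem_resolventSet_iff, ← IsUnit.neg_iff] at h
    convert h using 1
    simp [add_comm]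

end Resolvent

/-! ### Primitives of locally integrable functions -/

section Primitive

lemma _root_.AbsolutelyContinuousOnInterval.congr {F : Type*} [PseudoMetricSpace F] {f g : ℝ → F}
    {x y : ℝ} (hf : AbsolutelyContinuousOnInterval f x y) (h : EqOn f g (uIcc x y)) :
    AbsolutelyContinuousOnInterval g x y := by
  rw [absolutelyContinuousOnInterval_iff] at hf ⊢
  intro ε hε
  obtain ⟨δ, hδ, H⟩ := hf ε hε
  refine ⟨δ, hδ, fun E hE hs => ?_⟩
  convert H E hE hs using 1
  refine Finset.sum_congr rfl fun i hi => ?_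
  have := hE.1 i hi
  rw [h this.1, h this.2]

lemma absolutelyContinuousOnInterval_integral {f : ℝ → ℂ} {x y : ℝ}
    (hf : IntervalIntegrable f volume x y) :
    AbsolutelyContinuousOnInterval (fun t => ∫ s in x..t, f s) x y := by
  have hre : IntervalIntegrable (fun t => (f t).re) volume x y :=
    ⟨hf.1.re, hf.2.re⟩
  have him : IntervalIntegrable (fun t => (f t).im) volume x y :=
    ⟨hf.1.im, hf.2.im⟩
  have hconst : ∀ c : ℂ, AbsolutelyContinuousOnInterval (fun _ : ℝ => c) x y := fun c =>
    (LipschitzWith.const c).lipschitzOnWith.absolutelyContinuousOnInterval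
  have h1 := (hre.absolutelyContinuousOnInterval_intervalIntegral (c := x) left_mem_uIcc).fun_smul
    (hconst 1)
  have h2 := (him.absolutelyContinuousOnInterval_intervalIntegral (c := x) left_mem_uIcc).fun_smul
    (hconst Complex.I)
  refine (h1.fun_add h2).congr fun t ht => ?_
  have hsub : uIcc x t ⊆ uIcc x y := uIcc_subset_uIcc_left ht
  have e : ∀ s, f s = ((f s).re : ℂ) + ((f s).im : ℂ) * Complex.I :=
    fun s => (Complex.re_add_im _).symm
  have hre' : IntervalIntegrable (fun t => ((f t).re : ℂ)) volume x t :=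
    ⟨(hre.mono_set hsub).1.ofReal, (hre.mono_set hsub).2.ofReal⟩
  have him' : IntervalIntegrable (fun t => ((f t).im : ℂ)) volume x t :=
    ⟨(him.mono_set hsub).1.ofReal, (him.mono_set hsub).2.ofReal⟩
  conv_rhs => rw [intervalIntegral.integral_congr fun s _ => e s]
  rw [intervalIntegral.integral_add hre' (him'.mul_const _), intervalIntegral.integral_mul_const,
    intervalIntegral.integral_ofReal, intervalIntegral.integral_ofReal]
  simp

/-- Product rule for primitives of integrable functions, in integrated form. -/
lemma integral_mul_add_mul_of_primitive {F G f g : ℝ → ℂ} {x y : ℝ}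
    (hf : IntervalIntegrable f volume x y) (hg : IntervalIntegrable g volume x y)
    (hF : ∀ t ∈ uIcc x y, F t = F x + ∫ s in x..t, f s)
    (hG : ∀ t ∈ uIcc x y, G t = G x + ∫ s in x..t, g s) :
    IntervalIntegrable (fun t => f t * G t + F t * g t) volume x y ∧
      ∫ t in x..y, (f t * G t + F t * g t) = F y * G y - F x * G x := by
  have hconst : ∀ c : ℂ, AbsolutelyContinuousOnInterval (fun _ : ℝ => c) x y := fun c =>
    (LipschitzWith.const c).lipschitzOnWith.absolutelyContinuousOnInterval
  have aF : AbsolutelyContinuousOnInterval F x y :=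
    ((hconst (F x)).fun_add (absolutelyContinuousOnInterval_integral hf)).congr
      fun t ht => (hF t ht).symm
  have aG : AbsolutelyContinuousOnInterval G x y :=
    ((hconst (G x)).fun_add (absolutelyContinuousOnInterval_integral hg)).congr
      fun t ht => (hG t ht).symm
  have hint : IntervalIntegrable (fun t => f t * G t + F t * g t) volume x y :=
    (hf.mul_continuousOn aG.continuousOn).add (hg.continuousOn_mul aF.continuousOn)
  refine ⟨hint, ?_⟩
  have aH := (aF.fun_smul aG).fun_sub (absolutelyContinuousOnInterval_integral hint)
  obtain ⟨C, hC⟩ := aH.const_of_ae_hasDerivAt_zero (by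
    have hne : ∀ c : ℝ, ∀ᵐ t : ℝ, t ≠ c := fun c => by simp [ae_iff, measure_singleton]
    filter_upwards [hf.ae_hasDerivAt_integral, hg.ae_hasDerivAt_integral,
      hint.ae_hasDerivAt_integral, hne (min x y), hne (max x y)] with t h1 h2 h3 hx hy ht
    have hnhds : uIcc x y ∈ 𝓝 t :=
      Icc_mem_nhds (lt_of_le_of_ne ht.1 (Ne.symm hx)) (lt_of_le_of_ne ht.2 hy)
    have dF : HasDerivAt F (f t) t :=
      ((h1 ht x left_mem_uIcc).const_add (F x)).congr_of_eventuallyEq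
        (by filter_upwards [hnhds] with s hs using hF s hs)
    have dG : HasDerivAt G (g t) t :=
      ((h2 ht x left_mem_uIcc).const_add (G x)).congr_of_eventuallyEq
        (by filter_upwards [hnhds] with s hs using hG s hs)
    have := (dF.mul dG).sub (h3 ht x left_mem_uIcc)
    rw [sub_self] at this
    exact this)
  have h1 := hC x left_mem_uIcc
  have h2 := hC y right_mem_uIcc
  simp only [intervalIntegral.integral_same, sub_zero, smul_eq_mul] at h1 h2
  rw [← h1] at h2
  linear_combination -h2

/-- `F' = f` on the open interval `(a, b)` in the sense of locally absolutely continuous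
functions: `f` is locally integrable in `(a, b)` and increments of `F` are integrals of `f`. -/
def IsPrimitiveOn (a b : ℝ) (F f : ℝ → ℂ) : Prop :=
  ∀ x ∈ Ioo a b, ∀ y ∈ Ioo a b, IntervalIntegrable f volume x y ∧ F y - F x = ∫ t in x..y, f t

variable {a b : ℝ} {F G f g : ℝ → ℂ}

lemma uIcc_subset_Ioo_of_mem {x y : ℝ} (hx : x ∈ Ioo a b) (hy : y ∈ Ioo a b) :
    uIcc x y ⊆ Ioo a b := ordConnected_Ioo.uIcc_subset hx hy

lemma IsPrimitiveOn.congr {F' f' : ℝ → ℂ} (h : IsPrimitiveOn a b F f) (hF : EqOn F F' (Ioo a b))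
    (hf : EqOn f f' (Ioo a b)) : IsPrimitiveOn a b F' f' := by
  intro x hx y hy
  have hs := uIcc_subset_Ioo_of_mem hx hy
  obtain ⟨h1, h2⟩ := h x hx y hy
  refine ⟨h1.congr fun t ht => hf (hs (uIoc_subset_uIcc ht)), ?_⟩
  rw [← hF hx, ← hF hy, h2]
  exact intervalIntegral.integral_congr fun t ht => hf (hs ht)

lemma IsPrimitiveOn.congr_ae {f' : ℝ → ℂ} (h : IsPrimitiveOn a b F f)
    (hf : f =ᵐ[volume.restrict (Ioc a b)] f') : IsPrimitiveOn a b F f' := by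
  intro x hx y hy
  obtain ⟨h1, h2⟩ := h x hx y hy
  have hs : uIoc x y ⊆ Ioc a b :=
    (uIoc_subset_uIcc.trans (uIcc_subset_Ioo_of_mem hx hy)).trans Ioo_subset_Ioc_self
  have he := ae_restrict_of_ae_restrict_of_subset hs hf
  refine ⟨h1.congr_ae he, ?_⟩
  rw [h2]
  exact intervalIntegral.integral_congr_ae_restrict he

lemma IsPrimitiveOn.mul (hF : IsPrimitiveOn a b F f) (hG : IsPrimitiveOn a b G g) :
    IsPrimitiveOn a b (fun t => F t * G t) (fun t => f t * G t + F t * g t) := by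
  intro x hx y hy
  have hs := uIcc_subset_Ioo_of_mem hx hy
  obtain ⟨h1, h2⟩ := integral_mul_add_mul_of_primitive (hF x hx y hy).1 (hG x hx y hy).1
    (fun t ht => by rw [← (hF x hx t (hs ht)).2]; ring)
    (fun t ht => by rw [← (hG x hx t (hs ht)).2]; ring)
  exact ⟨h1, h2.symm⟩

lemma IsPrimitiveOn.conj (hF : IsPrimitiveOn a b F f) :
    IsPrimitiveOn a b (fun t => conj (F t)) (fun t => conj (f t)) := by
  intro x hx y hy
  obtain ⟨h1, h2⟩ := hF x hx y hy
  refine ⟨?_, ?_⟩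
  · rw [intervalIntegrable_iff] at h1 ⊢
    exact (LinearIsometryEquiv.integrable_comp_iff Complex.conjLIE).2 h1
  · rw [← map_sub, h2, intervalIntegral, intervalIntegral, map_sub, integral_conj, integral_conj]

lemma isPrimitiveOn_of_hasDerivAt (h : ∀ x ∈ Ioo a b, HasDerivAt F (f x) x)
    (hf : ContinuousOn f (Ioo a b)) : IsPrimitiveOn a b F f := by
  intro x hx y hy
  have hs := uIcc_subset_Ioo_of_mem hx hy
  have hi : IntervalIntegrable f volume x y := (hf.mono hs).intervalIntegrable
  exact ⟨hi, (intervalIntegral.integral_eq_sub_of_hasDerivAt (fun t ht => h t (hs ht)) hi).symm⟩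

/-- Reflection of an interval about its midpoint. -/
lemma IsPrimitiveOn.reflect (h : IsPrimitiveOn a b F f) :
    IsPrimitiveOn a b (fun t => F (a + b - t)) (fun t => -f (a + b - t)) := by
  intro x hx y hy
  have hx' : a + b - x ∈ Ioo a b := ⟨by linarith [hx.2], by linarith [hx.1]⟩
  have hy' : a + b - y ∈ Ioo a b := ⟨by linarith [hy.2], by linarith [hy.1]⟩
  obtain ⟨h1, h2⟩ := h _ hx' _ hy'
  refine ⟨?_, ?_⟩
  · have := (h1.comp_sub_left (a + b)).neg
    simp only [sub_sub_cancel] at this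
    exact this
  · rw [h2, intervalIntegral.integral_neg, intervalIntegral.integral_comp_sub_left,
      intervalIntegral.integral_symm]

end Primitive

/-! ### The degenerate weight on a half-period -/

section Weight

/-- The weight `(z - a)(b - z)/2`, which vanishes linearly at both ends of `[a, b]`. On each half
period it is the coefficient `c_* - U_*²` of the linearized operator. -/
def weight (a b z : ℝ) : ℝ := (z - a) * (b - z) / 2

variable {a b : ℝ} {F f : ℝ → ℂ}

lemma weight_pos {z : ℝ} (hz : z ∈ Ioo a b) : 0 < weight a b z := by
  have h1 := sub_pos.2 hz.1
  have h2 := sub_pos.2 hz.2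
  unfold weight
  positivity

lemma weight_reflect (z : ℝ) : weight a b (a + b - z) = weight a b z := by
  unfold weight
  ring

lemma hasDerivAt_weight (z : ℝ) : HasDerivAt (weight a b) ((a + b) / 2 - z) z := by
  have h := (((hasDerivAt_id z).sub_const a).mul ((hasDerivAt_id z).const_sub b)).div_const 2
  refine h.congr_deriv ?_
  simp only [id]
  ring

lemma continuous_weight : Continuous (weight a b) := by
  unfold weight
  fun_prop

/-- If `F' = f` is integrable up to `b` and so is `F` divided by the weight, then `F` vanishes at
`b`, since the reciprocal of the weight is not integrable there. -/
lemma IsPrimitiveOn.tendsto_right (hab : a < b) (hF : IsPrimitiveOn a b F f)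
    (hf : IntervalIntegrable f volume a b)
    (hq : IntervalIntegrable (fun z => F z / weight a b z) volume a b) :
    Tendsto F (𝓝[<] b) (𝓝 0) := by
  set m := (a + b) / 2 with hm
  have hmI : m ∈ Ioo a b := ⟨by linarith, by linarith⟩
  have hmb : IntervalIntegrable f volume m b := hf.mono_set (by
    rw [uIcc_of_le hmI.2.le, uIcc_of_le hab.le]; exact Icc_subset_Icc_left hmI.1.le)
  set L := F m + ∫ t in m..b, f t with hL
  have hlim : Tendsto F (𝓝[<] b) (𝓝 L) := by
    have hc : ContinuousOn (fun z => F m + ∫ t in m..z, f t) (Icc m b) := by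
      have h := intervalIntegral.continuousOn_primitive_interval' hmb left_mem_uIcc
      rw [uIcc_of_le hmI.2.le] at h
      exact continuousOn_const.add h
    have h1 := (hc b (right_mem_Icc.2 hmI.2.le)).tendsto
    have h2 : Tendsto (fun z => F m + ∫ t in m..z, f t) (𝓝[<] b) (𝓝 L) := by
      refine h1.mono_left ?_
      rw [← nhdsWithin_Ioo_eq_nhdsLT hmI.2]
      exact nhdsWithin_mono _ Ioo_subset_Icc_self
    refine h2.congr' ?_
    filter_upwards [Ioo_mem_nhdsLT hab] with z hz
    rw [← (hF m hmI z hz).2]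
    ring
  by_cases hL0 : L = 0
  · rwa [hL0] at hlim
  -- otherwise `|F| ≥ |L|/2` near `b`, and `F` over the weight dominates `1/(b - z)`
  exfalso
  have hpos : 0 < ‖L‖ := norm_pos_iff.2 hL0
  have hev : ∀ᶠ z in 𝓝[<] b, ‖L‖ / 2 < ‖F z‖ :=
    hlim.norm.eventually (lt_mem_nhds (by linarith))
  obtain ⟨c, hc, hcb⟩ := (mem_nhdsLT_iff_exists_mem_Ico_Ioo_subset hab).1 hev
  have hint : IntervalIntegrable (fun z => (z - b)⁻¹) volume c b := by
    have hq' : IntervalIntegrable (fun z => F z / weight a b z) volume c b := hq.mono_set (by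
      rw [uIcc_of_le hc.2.le, uIcc_of_le hab.le]; exact Icc_subset_Icc_left hc.1)
    refine (hq'.norm.const_mul ((b - a) / ‖L‖)).mono_fun
      (measurable_id.sub_const b).inv.aestronglyMeasurable ?_
    rw [uIoc_of_le hc.2.le]
    filter_upwards [ae_restrict_mem measurableSet_Ioc] with z hz
    rcases hz.2.eq_or_lt with rfl | hzb
    · rw [sub_self, inv_zero, norm_zero]
      exact norm_nonneg _
    · have hzI : z ∈ Ioo a b := ⟨hc.1.trans_lt hz.1, hzb⟩
      have hFz : ‖L‖ / 2 < ‖F z‖ := hcb ⟨hz.1, hzb⟩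
      have h1 := sub_pos.2 hzI.1
      have h2 := sub_pos.2 hzI.2
      have hba := sub_pos.2 hab
      have hw := weight_pos hzI
      rw [norm_mul, norm_norm, norm_div, norm_div, Complex.norm_real, Real.norm_of_nonneg hw.le,
        norm_inv, norm_sub_rev, Real.norm_of_nonneg h2.le, Real.norm_of_nonneg hba.le, norm_norm,
        div_mul_div_comm, le_div_iff₀ (by positivity), weight]
      have e : (b - z)⁻¹ * (‖L‖ * ((z - a) * (b - z) / 2)) = ‖L‖ / 2 * (z - a) := by
        field_simp
      rw [e]
      nlinarith
  rcases intervalIntegrable_sub_inv_iff.1 hint with h | h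
  · exact hc.2.ne h
  · exact h right_mem_uIcc

lemma IsPrimitiveOn.tendsto_left (hab : a < b) (hF : IsPrimitiveOn a b F f)
    (hf : IntervalIntegrable f volume a b)
    (hq : IntervalIntegrable (fun z => F z / weight a b z) volume a b) :
    Tendsto F (𝓝[>] a) (𝓝 0) := by
  have h := hF.reflect.tendsto_right hab
    (by
      have := ((hf.comp_sub_left (a + b)).neg).symm
      simp only [add_sub_cancel_left, add_sub_cancel_right] at this
      exact this)
    (by
      have := (hq.comp_sub_left (a + b)).symm
      simpa [weight_reflect] using this)
  have ht : Tendsto (fun z => a + b - z) (𝓝[>] a) (𝓝[<] b) := by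
    refine tendsto_nhdsWithin_iff.2 ⟨?_, ?_⟩
    · have : Tendsto (fun z => a + b - z) (𝓝 a) (𝓝 (a + b - a)) := by
        exact (continuous_const.sub continuous_id).tendsto a
      rw [add_sub_cancel_left] at this
      exact this.mono_left nhdsWithin_le_nhds
    · filter_upwards [self_mem_nhdsWithin] with z hz
      have : a < z := hz
      simp only [mem_Iio]
      linarith
  refine (h.comp ht).congr fun z => ?_
  simp

/-- The fundamental cancellation: the boundary terms at both ends of a half-period vanish. -/
lemma IsPrimitiveOn.integral_eq_zero (hab : a < b) (hF : IsPrimitiveOn a b F f)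
    (hf : IntervalIntegrable f volume a b)
    (hq : IntervalIntegrable (fun z => F z / weight a b z) volume a b) :
    ∫ z in a..b, f z = 0 := by
  set m := (a + b) / 2 with hm
  have hmI : m ∈ Ioo a b := ⟨by linarith, by linarith⟩
  have hmI' : m ∈ uIcc a b := by
    rw [uIcc_of_le hab.le]; exact Ioo_subset_Icc_self hmI
  have hc := intervalIntegral.continuousOn_primitive_interval' hf hmI'
  rw [uIcc_of_le hab.le] at hc
  have hb : Tendsto (fun z => ∫ t in m..z, f t) (𝓝[<] b) (𝓝 (∫ t in m..b, f t)) := by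
    refine (hc b (right_mem_Icc.2 hab.le)).tendsto.mono_left ?_
    rw [← nhdsWithin_Ioo_eq_nhdsLT hab]
    exact nhdsWithin_mono _ Ioo_subset_Icc_self
  have ha : Tendsto (fun z => ∫ t in m..z, f t) (𝓝[>] a) (𝓝 (∫ t in m..a, f t)) := by
    refine (hc a (left_mem_Icc.2 hab.le)).tendsto.mono_left ?_
    rw [← nhdsWithin_Ioo_eq_nhdsGT hab]
    exact nhdsWithin_mono _ Ioo_subset_Icc_self
  have hb' : Tendsto (fun z => ∫ t in m..z, f t) (𝓝[<] b) (𝓝 (0 - F m)) :=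
    ((hF.tendsto_right hab hf hq).sub_const (F m)).congr' (by
      filter_upwards [Ioo_mem_nhdsLT hab] with z hz using (hF m hmI z hz).2)
  have ha' : Tendsto (fun z => ∫ t in m..z, f t) (𝓝[>] a) (𝓝 (0 - F m)) :=
    ((hF.tendsto_left hab hf hq).sub_const (F m)).congr' (by
      filter_upwards [Ioo_mem_nhdsGT hab] with z hz using (hF m hmI z hz).2)
  have e1 := tendsto_nhds_unique hb hb'
  have e2 := tendsto_nhds_unique ha ha'
  rw [← intervalIntegral.integral_add_adjacent_intervals (b := m)
    (hf.mono_set (uIcc_subset_uIcc_left hmI')) (hf.mono_set (uIcc_subset_uIcc_right hmI')),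
    intervalIntegral.integral_symm, e1, e2]
  ring

end Weight

/-! ### The transport equation on a half-period -/

section Transport

variable {a b : ℝ} {v g f : ℝ → ℂ}

lemma intervalIntegrable_of_memLp_two {E : Type*} [NormedAddCommGroup E] {u : ℝ → E} (hab : a < b)
    (hu : MemLp u 2 (volume.restrict (Ioc a b))) : IntervalIntegrable u volume a b :=
  (intervalIntegrable_iff_integrableOn_Ioc_of_le hab.le).2 (hu.integrable (by norm_num))

lemma intervalIntegrable_mul_of_memLp_two {u w : ℝ → ℂ} (hab : a < b)
    (hu : MemLp u 2 (volume.restrict (Ioc a b))) (hw : MemLp w 2 (volume.restrict (Ioc a b))) :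
    IntervalIntegrable (fun z => u z * w z) volume a b :=
  (intervalIntegrable_iff_integrableOn_Ioc_of_le hab.le).2 (hu.integrable_mul hw)

lemma memLp_two_conj {u : ℝ → ℂ} {μ : Measure ℝ} (hu : MemLp u 2 μ) :
    MemLp (fun z => conj (u z)) 2 μ := hu.star

/-- `(w v)' = g` on `(a, b)` for the weight `w`, where `w v` is locally absolutely continuous. -/
def HasFluxDerivOn (a b : ℝ) (v g : ℝ → ℂ) : Prop :=
  IsPrimitiveOn a b (fun z => (weight a b z : ℂ) * v z) g

/-- The travel time `∫ dz / w(z)`, a coordinate that maps `(a, b)` onto the real line. -/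
def travelTime (a b z : ℝ) : ℝ := 2 / (b - a) * Real.log ((z - a) / (b - z))

lemma hasDerivAt_travelTime {z : ℝ} (hz : z ∈ Ioo a b) :
    HasDerivAt (travelTime a b) (weight a b z)⁻¹ z := by
  have h1 := sub_pos.2 hz.1
  have h2 := sub_pos.2 hz.2
  have h3 : 0 < b - a := by linarith
  have hq : HasDerivAt (fun z => (z - a) / (b - z)) ((1 * (b - z) - (z - a) * (-1)) / (b - z) ^ 2)
      z := ((hasDerivAt_id z).sub_const a).div ((hasDerivAt_id z).const_sub b) h2.ne'
  have hl := (hq.log (div_pos h1 h2).ne').const_mul (2 / (b - a))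
  refine hl.congr_deriv ?_
  unfold weight
  field_simp
  ring

lemma norm_cexp_mul_travelTime (c : ℂ) (z : ℝ) :
    ‖Complex.exp (c * travelTime a b z)‖ = Real.exp (c.re * travelTime a b z) := by
  rw [Complex.norm_exp]
  simp

lemma hasDerivAt_cexp_travelTime (c : ℂ) {z : ℝ} (hz : z ∈ Ioo a b) :
    HasDerivAt (fun z => Complex.exp (c * travelTime a b z))
      (c / weight a b z * Complex.exp (c * travelTime a b z)) z := by
  have h := ((hasDerivAt_travelTime hz).ofReal_comp.const_mul c).cexp
  refine h.congr_deriv ?_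
  push_cast
  ring

lemma continuousOn_travelTime : ContinuousOn (travelTime a b) (Ioo a b) := fun _ hz =>
  (hasDerivAt_travelTime hz).continuousAt.continuousWithinAt

lemma isPrimitiveOn_cexp_travelTime (c : ℂ) :
    IsPrimitiveOn a b (fun z => Complex.exp (c * travelTime a b z))
      (fun z => c / weight a b z * Complex.exp (c * travelTime a b z)) := by
  refine isPrimitiveOn_of_hasDerivAt (fun z hz => hasDerivAt_cexp_travelTime c hz) ?_
  refine ContinuousOn.mul (continuousOn_const.div ?_ fun z hz => ?_) ?_
  · exact (Complex.continuous_ofReal.comp continuous_weight).continuousOn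
  · exact Complex.ofReal_ne_zero.2 (weight_pos hz).ne'
  · exact fun z hz => (hasDerivAt_cexp_travelTime c hz).continuousAt.continuousWithinAt

lemma HasFluxDerivOn.mul_cexp (h : HasFluxDerivOn a b v g) (c : ℂ) :
    IsPrimitiveOn a b
      (fun z => (weight a b z : ℂ) * v z * Complex.exp (-c * travelTime a b z))
      (fun z => (g z - c * v z) * Complex.exp (-c * travelTime a b z)) := by
  refine (h.mul (isPrimitiveOn_cexp_travelTime (-c))).congr (fun z _ => rfl) fun z hz => ?_
  have := Complex.ofReal_ne_zero.2 (weight_pos hz).ne'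
  simp only
  field_simp
  ring

lemma weight_mul_mul_div {z : ℝ} (hz : z ∈ Ioo a b) (c d : ℂ) :
    (weight a b z : ℂ) * c * d / weight a b z = c * d := by
  have := Complex.ofReal_ne_zero.2 (weight_pos hz).ne'
  field_simp

lemma intervalIntegrable_congr_Ioo {u w : ℝ → ℂ} (hab : a < b)
    (h : IntervalIntegrable u volume a b) (he : EqOn u w (Ioo a b)) :
    IntervalIntegrable w volume a b := by
  rw [intervalIntegrable_iff_integrableOn_Ioo_of_le hab.le] at h ⊢
  exact h.congr_fun he measurableSet_Ioo

lemma intervalIntegrable_weight_mul_div (hab : a < b) {e : ℝ → ℂ}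
    (hv : IntervalIntegrable (fun z => v z * e z) volume a b) :
    IntervalIntegrable (fun z => (weight a b z : ℂ) * v z * e z / weight a b z) volume a b :=
  intervalIntegrable_congr_Ioo hab hv fun _ hz => (weight_mul_mul_div hz _ _).symm

/-- Local form of the energy identity: `(w |v|²)' = 2 Re (g v̄) - w' |v|²` when `(w v)' = g`. -/
lemma HasFluxDerivOn.energy_primitive (h : HasFluxDerivOn a b v g) :
    IsPrimitiveOn a b (fun z => (weight a b z : ℂ) * v z * conj (v z))
      (fun z => g z * conj (v z) + v z * conj (g z)
        - (((a + b) / 2 - z : ℝ) : ℂ) * (v z * conj (v z))) := by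
  have hinv : IsPrimitiveOn a b (fun z => (weight a b z : ℂ)⁻¹)
      (fun z => -(((a + b) / 2 - z : ℝ) : ℂ) / (weight a b z : ℂ) ^ 2) := by
    refine isPrimitiveOn_of_hasDerivAt (fun z hz => ?_) ?_
    · exact (hasDerivAt_weight z).ofReal_comp.inv (Complex.ofReal_ne_zero.2 (weight_pos hz).ne')
    · refine ContinuousOn.div (by fun_prop) ?_ fun z hz =>
        pow_ne_zero 2 (Complex.ofReal_ne_zero.2 (weight_pos hz).ne')
      exact ((Complex.continuous_ofReal.comp continuous_weight).pow 2).continuousOn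
  refine ((IsPrimitiveOn.mul h h.conj).mul hinv).congr (fun z hz => ?_) fun z hz => ?_
  all_goals
    have := Complex.ofReal_ne_zero.2 (weight_pos hz).ne'
    simp only [map_mul, Complex.conj_ofReal]
    field_simp
  ring

/-- Energy estimate: since `|w'| ≤ (b - a)/2` and no boundary terms appear, the quadratic form of
`v ↦ (w v)'` is bounded by `(b - a)/4`. -/
lemma HasFluxDerivOn.abs_re_integral_le (hab : a < b) (h : HasFluxDerivOn a b v g)
    (hv : MemLp v 2 (volume.restrict (Ioc a b))) (hg : MemLp g 2 (volume.restrict (Ioc a b))) :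
    |(∫ z in a..b, g z * conj (v z)).re| ≤ (b - a) / 4 * ∫ z in a..b, ‖v z‖ ^ 2 := by
  have hvv := intervalIntegrable_mul_of_memLp_two hab hv (memLp_two_conj hv)
  have hgv := intervalIntegrable_mul_of_memLp_two hab hg (memLp_two_conj hv)
  have hvg := intervalIntegrable_mul_of_memLp_two hab hv (memLp_two_conj hg)
  have hq : IntervalIntegrable (fun z => (((a + b) / 2 - z : ℝ) : ℂ) * (v z * conj (v z)))
      volume a b := hvv.continuousOn_mul (by fun_prop)
  have h0 := h.energy_primitive.integral_eq_zero hab ((hgv.add hvg).sub hq)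
    (intervalIntegrable_weight_mul_div hab hvv)
  rw [intervalIntegral.integral_sub (hgv.add hvg) hq, intervalIntegral.integral_add hgv hvg] at h0
  have hconj : ∫ z in a..b, v z * conj (g z) = conj (∫ z in a..b, g z * conj (v z)) := by
    rw [intervalIntegral.integral_of_le hab.le, intervalIntegral.integral_of_le hab.le,
      ← integral_conj]
    congr 1
    ext z
    simp [mul_comm]
  have hqr : ∫ z in a..b, (((a + b) / 2 - z : ℝ) : ℂ) * (v z * conj (v z)) =
      ((∫ z in a..b, ((a + b) / 2 - z) * ‖v z‖ ^ 2 : ℝ) : ℂ) := by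
    rw [← intervalIntegral.integral_ofReal]
    congr 1
    ext z
    rw [Complex.mul_conj']
    push_cast
    ring
  rw [hconj, Complex.add_conj, hqr, sub_eq_zero] at h0
  have h0' := Complex.ofReal_injective h0
  have hsq : IntervalIntegrable (fun z => ‖v z‖ ^ 2) volume a b :=
    (intervalIntegrable_iff_integrableOn_Ioc_of_le hab.le).2 (hv.integrable_norm_pow (by norm_num))
  have hbound : |∫ z in a..b, ((a + b) / 2 - z) * ‖v z‖ ^ 2| ≤
      ∫ z in a..b, (b - a) / 2 * ‖v z‖ ^ 2 := by
    rw [← Real.norm_eq_abs]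
    refine intervalIntegral.norm_integral_le_of_norm_le hab.le (ae_of_all _ fun z hz => ?_)
      (hsq.const_mul _)
    rw [norm_mul, norm_pow, norm_norm]
    gcongr
    rw [Real.norm_eq_abs, abs_le]
    constructor <;> linarith [hz.1, hz.2]
  rw [intervalIntegral.integral_const_mul] at hbound
  rw [← h0', abs_mul, abs_two] at hbound
  linarith

/-- `v ↦ (w v)'` has no square-integrable eigenfunctions: they are multiples of `e^{c τ}/w` with
`τ` the travel time, and `w v` would have to vanish at both ends. -/
lemma HasFluxDerivOn.eq_zero_of_eigen (hab : a < b) {c : ℂ}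
    (h : HasFluxDerivOn a b v (fun z => c * v z)) (hv : IntervalIntegrable v volume a b) :
    ∀ z ∈ Ioo a b, v z = 0 := by
  have hc := h.mul_cexp c
  simp only [sub_self, zero_mul] at hc
  have hdiv : IntervalIntegrable (fun z => (weight a b z : ℂ) * v z / weight a b z) volume a b := by
    have := intervalIntegrable_weight_mul_div hab (v := v) (e := fun _ => 1) (by simpa using hv)
    simpa using this
  have hr := IsPrimitiveOn.tendsto_right hab h (hv.const_mul c) hdiv
  have hl := IsPrimitiveOn.tendsto_left hab h (hv.const_mul c) hdiv
  set m := (a + b) / 2 with hm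
  have hmI : m ∈ Ioo a b := ⟨by linarith, by linarith⟩
  set C := (weight a b m : ℂ) * v m * Complex.exp (-c * travelTime a b m) with hC
  have hconst : ∀ z ∈ Ioo a b,
      (weight a b z : ℂ) * v z = C * Complex.exp (c * travelTime a b z) := by
    intro z hz
    have := (hc m hmI z hz).2
    simp only [intervalIntegral.integral_zero] at this
    rw [hC, ← sub_eq_zero.1 this, mul_assoc, ← Complex.exp_add]
    simp
  have hC0 : C = 0 := by
    by_contra hne
    have hpos := norm_pos_iff.2 hne
    -- `|e^{c τ}| ≥ 1` near one of the two ends, depending on the sign of `Re c`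
    have key : ∀ l : Filter ℝ, l.NeBot → Tendsto (fun z => (weight a b z : ℂ) * v z) l (𝓝 0) →
        (∀ᶠ z in l, z ∈ Ioo a b ∧ 0 ≤ c.re * travelTime a b z) → False := by
      intro l hl0 hl hev
      have h1 : ∀ᶠ z in l, ‖(weight a b z : ℂ) * v z‖ < ‖C‖ :=
        hl.norm.eventually (gt_mem_nhds (by simpa using hpos))
      obtain ⟨z, ⟨hz, hs⟩, hlt⟩ := (hev.and h1).exists
      rw [hconst z hz, norm_mul, norm_cexp_mul_travelTime] at hlt
      have := Real.one_le_exp hs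
      nlinarith
    have hba : 0 < 2 / (b - a) := div_pos two_pos (sub_pos.2 hab)
    rcases le_total 0 c.re with hre | hre
    · refine key (𝓝[<] b) inferInstance hr ?_
      filter_upwards [Ioo_mem_nhdsLT hmI.2] with z hz
      refine ⟨⟨hmI.1.trans hz.1, hz.2⟩, mul_nonneg hre (mul_nonneg hba.le (Real.log_nonneg ?_))⟩
      rw [one_le_div (sub_pos.2 hz.2)]
      linarith [hz.1]
    · refine key (𝓝[>] a) inferInstance hl ?_
      filter_upwards [Ioo_mem_nhdsGT hmI.1] with z hz
      have hzb : z < b := hz.2.trans hmI.2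
      refine ⟨⟨hz.1, hzb⟩, mul_nonneg_of_nonpos_of_nonpos hre
        (mul_nonpos_of_nonneg_of_nonpos hba.le (Real.log_nonpos ?_ ?_))⟩
      · exact div_nonneg (sub_pos.2 hz.1).le (sub_pos.2 hzb).le
      · rw [div_le_one (sub_pos.2 hzb)]
        linarith [hz.2]
  intro z hz
  have := hconst z hz
  rw [hC0, zero_mul] at this
  exact (mul_eq_zero.1 this).resolve_left (Complex.ofReal_ne_zero.2 (weight_pos hz).ne')

/-- The homogeneous adjoint solution `e^{c τ}` is square integrable for `|Re c| < (b - a)/4`. -/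
lemma memLp_cexp_travelTime (hab : a < b) {c : ℂ} (hc : |c.re| < (b - a) / 4) :
    MemLp (fun z => Complex.exp (c * travelTime a b z)) 2 (volume.restrict (Ioc a b)) := by
  have hba := sub_pos.2 hab
  have hmeas : AEStronglyMeasurable (fun z => Complex.exp (c * travelTime a b z))
      (volume.restrict (Ioc a b)) := by
    rw [← restrict_Ioo_eq_restrict_Ioc]
    refine ContinuousOn.aestronglyMeasurable (fun z hz => ?_) measurableSet_Ioo
    exact (hasDerivAt_cexp_travelTime c hz).continuousAt.continuousWithinAt
  rw [memLp_two_iff_integrable_sq_norm hmeas]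
  set r := 4 * |c.re| / (b - a) with hr
  have hr0 : 0 ≤ r := by positivity
  have hr1 : r < 1 := by
    rw [hr, div_lt_one hba]
    linarith
  have hbd : IntervalIntegrable
      (fun z => (b - a) ^ r * ((z - a) ^ (-r) + (b - z) ^ (-r))) volume a b := by
    have h0 : IntervalIntegrable (fun z : ℝ => z ^ (-r)) volume 0 (b - a) :=
      intervalIntegral.intervalIntegrable_rpow' (by linarith)
    have h1 := h0.comp_sub_right a
    have h2 := (h0.comp_sub_left b).symm
    simp only [zero_add, sub_add_cancel] at h1
    simp only [sub_zero, sub_sub_cancel] at h2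
    exact (h1.add h2).const_mul _
  have hbd' := (intervalIntegrable_iff_integrableOn_Ioc_of_le hab.le).1 hbd
  refine Integrable.mono' hbd' (hmeas.norm.pow 2) ?_
  rw [← restrict_Ioo_eq_restrict_Ioc]
  filter_upwards [ae_restrict_mem measurableSet_Ioo] with z hz
  have h1 := sub_pos.2 hz.1
  have h2 := sub_pos.2 hz.2
  rw [norm_pow, norm_norm, norm_cexp_mul_travelTime, ← Real.exp_nat_mul]
  have hle : ((2 : ℕ) : ℝ) * (c.re * travelTime a b z) ≤ r * |Real.log ((z - a) / (b - z))| := by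
    have : ((2 : ℕ) : ℝ) * (c.re * travelTime a b z) =
        4 / (b - a) * (c.re * Real.log ((z - a) / (b - z))) := by
      unfold travelTime
      push_cast
      field_simp
      ring
    rw [this, hr, mul_div_right_comm, mul_assoc, ← abs_mul]
    gcongr
    exact le_abs_self _
  refine (Real.exp_le_exp.2 hle).trans ?_
  have hp1 : 0 ≤ (b - a) ^ r * (z - a) ^ (-r) := by positivity
  have hp2 : 0 ≤ (b - a) ^ r * (b - z) ^ (-r) := by positivity
  rw [mul_add]
  rcases le_total 0 (Real.log ((z - a) / (b - z))) with hl | hl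
  · rw [abs_of_nonneg hl, mul_comm, ← Real.rpow_def_of_pos (div_pos h1 h2),
      Real.div_rpow h1.le h2.le, div_eq_mul_inv, ← Real.rpow_neg h2.le]
    have : (z - a) ^ r ≤ (b - a) ^ r := Real.rpow_le_rpow h1.le (by linarith) hr0
    have := mul_le_mul_of_nonneg_right this (Real.rpow_nonneg h2.le (-r))
    linarith
  · rw [abs_of_nonpos hl, ← Real.log_inv, inv_div, mul_comm,
      ← Real.rpow_def_of_pos (div_pos h2 h1), Real.div_rpow h2.le h1.le, div_eq_mul_inv,
      ← Real.rpow_neg h1.le]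
    have : (b - z) ^ r ≤ (b - a) ^ r := Real.rpow_le_rpow h2.le (by linarith) hr0
    have := mul_le_mul_of_nonneg_right this (Real.rpow_nonneg h1.le (-r))
    linarith

/-- For `|Re c| < (b - a)/4` the range of `v ↦ (w v)' - c v` is annihilated by `e^{-c τ}`. -/
lemma HasFluxDerivOn.integral_mul_cexp_eq_zero (hab : a < b) {c : ℂ} (hc : |c.re| < (b - a) / 4)
    (h : HasFluxDerivOn a b v (fun z => f z + c * v z))
    (hv : MemLp v 2 (volume.restrict (Ioc a b))) (hf : MemLp f 2 (volume.restrict (Ioc a b))) :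
    ∫ z in a..b, f z * Complex.exp (-c * travelTime a b z) = 0 := by
  have he := memLp_cexp_travelTime hab (c := -c) (by simpa using hc)
  have hp := h.mul_cexp c
  simp only [add_sub_cancel_right] at hp
  exact hp.integral_eq_zero hab (intervalIntegrable_mul_of_memLp_two hab hf he)
    (intervalIntegrable_weight_mul_div hab (intervalIntegrable_mul_of_memLp_two hab hv he))

end Transport

/-! ### Solving the resolvent equation on a half-period -/

section Solve

variable {a b : ℝ} {v g f : ℝ → ℂ}

lemma IsPrimitiveOn.continuousOn {F : ℝ → ℂ} (h : IsPrimitiveOn a b F f) :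
    ContinuousOn F (Ioo a b) := by
  intro x hx
  obtain ⟨c, hc, hcx⟩ := exists_between hx.1
  obtain ⟨d, hxd, hd⟩ := exists_between hx.2
  have hcI : c ∈ Ioo a b := ⟨hc, hcx.trans hx.2⟩
  have hdI : d ∈ Ioo a b := ⟨hx.1.trans hxd, hd⟩
  have hcont := intervalIntegral.continuousOn_primitive_interval' (h c hcI d hdI).1 left_mem_uIcc
  rw [uIcc_of_le (hcx.trans hxd).le] at hcont
  have hn : Icc c d ∈ 𝓝 x := Icc_mem_nhds hcx hxd
  refine (ContinuousAt.congr (f := fun z => F c + ∫ t in c..z, f t)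
    (continuousAt_const.add (hcont.continuousAt hn)) ?_).continuousWithinAt
  filter_upwards [hn] with z hz
  rw [← (h c hcI z ⟨hc.trans_le hz.1, hz.2.trans_lt hd⟩).2]
  ring

/-- The Cauchy–Schwarz inequality `(∫ |f|)² ≤ (y - x) ∫ |f|²`. -/
lemma sq_integral_norm_le {x y : ℝ} (hxy : x ≤ y)
    (hf : MemLp f 2 (volume.restrict (Ioc x y))) :
    (∫ t in x..y, ‖f t‖) ^ 2 ≤ (y - x) * ∫ t in x..y, ‖f t‖ ^ 2 := by
  rcases hxy.eq_or_lt with rfl | hlt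
  · simp
  have h1 : IntervalIntegrable (fun t => ‖f t‖) volume x y :=
    (intervalIntegrable_of_memLp_two hlt hf).norm
  have h2 : IntervalIntegrable (fun t => ‖f t‖ ^ 2) volume x y :=
    (intervalIntegrable_iff_integrableOn_Ioc_of_le hxy).2 (hf.integrable_norm_pow (by norm_num))
  set I := ∫ t in x..y, ‖f t‖
  -- expand the square of the deviation of `|f|` from its mean, scaled by `y - x`
  have hpos : 0 ≤ ∫ t in x..y, ((y - x) * ‖f t‖ - I) ^ 2 :=
    intervalIntegral.integral_nonneg hxy fun _ _ => sq_nonneg _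
  have e : ∀ t, ((y - x) * ‖f t‖ - I) ^ 2 =
      (y - x) ^ 2 * ‖f t‖ ^ 2 - 2 * (y - x) * I * ‖f t‖ + I ^ 2 := fun t => by ring
  simp only [e] at hpos
  rw [intervalIntegral.integral_add ((h2.const_mul _).sub (h1.const_mul _)) (by simp),
    intervalIntegral.integral_sub (h2.const_mul _) (h1.const_mul _),
    intervalIntegral.integral_const_mul, intervalIntegral.integral_const_mul,
    intervalIntegral.integral_const, smul_eq_mul] at hpos
  have hyx := sub_pos.2 hlt
  have : 0 ≤ (y - x) * ((y - x) * (∫ t in x..y, ‖f t‖ ^ 2) - I ^ 2) := by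
    change 0 ≤ (y - x) ^ 2 * (∫ t in x..y, ‖f t‖ ^ 2) - 2 * (y - x) * I * I
      + (y - x) * I ^ 2 at hpos
    linarith
  have := nonneg_of_mul_nonneg_right this hyx
  linarith

lemma travelTime_monotoneOn : MonotoneOn (travelTime a b) (Ioo a b) := by
  refine monotoneOn_of_deriv_nonneg (convex_Ioo a b) continuousOn_travelTime ?_ ?_
  · intro z hz
    rw [interior_Ioo] at hz
    exact (hasDerivAt_travelTime hz).differentiableAt.differentiableWithinAt
  · intro z hz
    rw [interior_Ioo] at hz
    rw [(hasDerivAt_travelTime hz).deriv]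
    exact (inv_pos.2 (weight_pos hz)).le

/-- An a priori bound on `w |v|²` near the right end gives `v ∈ L²`: in the identity
`(w |v|²)' = 2 Re (f v̄) + (2 Re c - w') |v|²` the last coefficient is bounded below by a positive
constant, and the contribution of the left end has a favourable sign. -/
lemma HasFluxDerivOn.memLp_of_bound (hab : a < b) {c : ℂ} (hc : (b - a) / 4 < c.re)
    (h : HasFluxDerivOn a b v (fun z => f z + c * v z))
    (hf : MemLp f 2 (volume.restrict (Ioc a b))) {M : ℝ}
    (hM : ∀ z ∈ Ioo ((a + b) / 2) b, weight a b z * ‖v z‖ ^ 2 ≤ M) :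
    MemLp v 2 (volume.restrict (Ioc a b)) := by
  have hcont : ContinuousOn v (Ioo a b) := by
    have hw : ContinuousOn (fun z => (weight a b z : ℂ)) (Ioo a b) :=
      (Complex.continuous_ofReal.comp continuous_weight).continuousOn
    refine ((IsPrimitiveOn.continuousOn h).div hw fun z hz =>
      Complex.ofReal_ne_zero.2 (weight_pos hz).ne').congr fun z hz => ?_
    have := Complex.ofReal_ne_zero.2 (weight_pos hz).ne'
    simp only [Pi.div_apply]
    field_simp
  have hmeas : AEStronglyMeasurable v (volume.restrict (Ioc a b)) := by
    rw [← restrict_Ioo_eq_restrict_Ioc]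
    exact hcont.aestronglyMeasurable measurableSet_Ioo
  rw [memLp_two_iff_integrable_sq_norm hmeas]
  have hf2 : IntervalIntegrable (fun z => ‖f z‖ ^ 2) volume a b :=
    (intervalIntegrable_iff_integrableOn_Ioc_of_le hab.le).2 (hf.integrable_norm_pow (by norm_num))
  set N := ∫ z in a..b, ‖f z‖ ^ 2 with hN
  set δ := 2 * c.re - (b - a) / 2 with hδ
  have hδ0 : 0 < δ := by rw [hδ]; linarith
  -- the energy balance on `[x, y]`
  have hbal : ∀ x ∈ Ioo a ((a + b) / 2), ∀ y ∈ Ioo ((a + b) / 2) b,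
      ∫ z in x..y, ‖v z‖ ^ 2 ≤ 2 / δ * (M + 2 / δ * N) := by
    intro x hx y hy
    have hxI : x ∈ Ioo a b := ⟨hx.1, by linarith [hx.2]⟩
    have hyI : y ∈ Ioo a b := ⟨by linarith [hy.1], hy.2⟩
    have hxy : x ≤ y := (hx.2.trans hy.1).le
    have hsub : Icc x y ⊆ Ioo a b := fun t ht => ⟨hx.1.trans_le ht.1, ht.2.trans_lt hy.2⟩
    have hv2 : IntervalIntegrable (fun z => ‖v z‖ ^ 2) volume x y := by
      refine ContinuousOn.intervalIntegrable ?_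
      rw [uIcc_of_le hxy]
      exact (hcont.mono hsub).norm.pow 2
    have hf2' : IntervalIntegrable (fun z => ‖f z‖ ^ 2) volume x y := hf2.mono_set (by
      rw [uIcc_of_le hxy, uIcc_of_le hab.le]
      exact hsub.trans Ioo_subset_Icc_self)
    obtain ⟨hi, he⟩ := h.energy_primitive x hxI y hyI
    have hre := congrArg Complex.re he
    have hire := intervalIntegral.intervalIntegral_re (𝕜 := ℂ) hi
    have hwv : ∀ z, ((weight a b z : ℂ) * v z * conj (v z)).re = weight a b z * ‖v z‖ ^ 2 := by
      intro z
      rw [mul_assoc, Complex.mul_conj', ← Complex.ofReal_pow, ← Complex.ofReal_mul,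
        Complex.ofReal_re]
    rw [Complex.sub_re, hwv, hwv] at hre
    have hlow : ∫ z in x..y, (δ / 2 * ‖v z‖ ^ 2 - 2 / δ * ‖f z‖ ^ 2) ≤
        weight a b y * ‖v y‖ ^ 2 - weight a b x * ‖v x‖ ^ 2 := by
      rw [hre, ← RCLike.re_to_complex, ← hire]
      refine intervalIntegral.integral_mono_on hxy ((hv2.const_mul _).sub (hf2'.const_mul _))
        ⟨hi.1.re, hi.2.re⟩ fun z hz => ?_
      have hzI := hsub hz
      have e : RCLike.re ((f z + c * v z) * conj (v z) + v z * conj (f z + c * v z)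
          - (((a + b) / 2 - z : ℝ) : ℂ) * (v z * conj (v z))) =
          2 * (f z * conj (v z)).re + (2 * c.re - ((a + b) / 2 - z)) * ‖v z‖ ^ 2 := by
        rw [← Complex.normSq_eq_norm_sq, Complex.normSq_apply]
        simp only [RCLike.re_to_complex, Complex.sub_re, Complex.add_re, Complex.mul_re,
          Complex.conj_re, Complex.conj_im, Complex.add_im, Complex.mul_im, Complex.ofReal_re,
          Complex.ofReal_im]
        ring
      rw [e]
      have h1 : -(‖f z‖ * ‖v z‖) ≤ (f z * conj (v z)).re := by
        have := Complex.abs_re_le_norm (f z * conj (v z))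
        rw [norm_mul, RCLike.norm_conj] at this
        exact neg_le_of_abs_le this
      have h2 : δ ≤ 2 * c.re - ((a + b) / 2 - z) := by
        rw [hδ]; linarith [hzI.1]
      have h3 := mul_le_mul_of_nonneg_right h2 (sq_nonneg ‖v z‖)
      have h4 : 2 * (‖f z‖ * ‖v z‖) ≤ δ / 2 * ‖v z‖ ^ 2 + 2 / δ * ‖f z‖ ^ 2 := by
        have := sq_nonneg (δ * ‖v z‖ - 2 * ‖f z‖)
        have e2 : δ / 2 * ‖v z‖ ^ 2 + 2 / δ * ‖f z‖ ^ 2 - 2 * (‖f z‖ * ‖v z‖) =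
            (δ * ‖v z‖ - 2 * ‖f z‖) ^ 2 / (2 * δ) := by
          field_simp
          ring
        have := div_nonneg this (by positivity : (0 : ℝ) ≤ 2 * δ)
        linarith
      linarith
    rw [intervalIntegral.integral_sub (hv2.const_mul _) (hf2'.const_mul _),
      intervalIntegral.integral_const_mul, intervalIntegral.integral_const_mul] at hlow
    have hfN : ∫ z in x..y, ‖f z‖ ^ 2 ≤ N :=
      intervalIntegral.integral_mono_interval hxI.1.le hxy hyI.2.le
        (ae_of_all _ fun _ => by positivity) hf2
    have hx0 : 0 ≤ weight a b x * ‖v x‖ ^ 2 := mul_nonneg (weight_pos hxI).le (sq_nonneg _)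
    have hy0 := hM y hy
    have hfN' := mul_le_mul_of_nonneg_left hfN (by positivity : 0 ≤ 2 / δ)
    have : δ / 2 * ∫ z in x..y, ‖v z‖ ^ 2 ≤ M + 2 / δ * N := by linarith
    calc ∫ z in x..y, ‖v z‖ ^ 2 = 2 / δ * (δ / 2 * ∫ z in x..y, ‖v z‖ ^ 2) := by
          field_simp
      _ ≤ _ := mul_le_mul_of_nonneg_left this (by positivity)
  -- exhaust `(a, b)` by the intervals `[a + ε n, b - ε n]`
  set ε : ℕ → ℝ := fun n => (b - a) / (n + 3) with hε
  have hba := sub_pos.2 hab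
  have hε0 : ∀ n, 0 < ε n := fun n => by positivity
  have hε1 : ∀ n, ε n < (b - a) / 2 := fun n => by
    apply div_lt_div_of_pos_left hba two_pos
    have : (0 : ℝ) ≤ n := n.cast_nonneg
    linarith
  have hεt : Tendsto ε atTop (𝓝 0) :=
    tendsto_const_nhds.div_atTop (tendsto_atTop_add_const_right _ _ tendsto_natCast_atTop_atTop)
  refine integrableOn_Ioc_of_intervalIntegral_norm_bounded (I := 2 / δ * (M + 2 / δ * N))
    (l := atTop) (a := fun n => a + ε n) (b := fun n => b - ε n) (fun n => ?_)
    (by simpa using hεt.const_add a) (by simpa using hεt.const_sub b)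
    (Eventually.of_forall fun n => ?_)
  · have hsub : Icc (a + ε n) (b - ε n) ⊆ Ioo a b := fun t ht =>
      ⟨by linarith [ht.1, hε0 n], by linarith [ht.2, hε0 n]⟩
    exact (((hcont.mono hsub).norm.pow 2).integrableOn_Icc).mono_set Ioc_subset_Icc_self
  · rw [← intervalIntegral.integral_of_le (by linarith [hε1 n])]
    simp only [norm_pow, norm_norm]
    exact hbal _ ⟨by linarith [hε0 n], by linarith [hε1 n]⟩ _
      ⟨by linarith [hε1 n], by linarith [hε0 n]⟩

/-- Solvability of `(w v)' - c v = f` to the right of the strip, by integration from the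
endpoint `b`. -/
lemma exists_hasFluxDerivOn_of_lt (hab : a < b) {c : ℂ} (hc : (b - a) / 4 < c.re)
    (hf : MemLp f 2 (volume.restrict (Ioc a b))) :
    ∃ v : ℝ → ℂ, MemLp v 2 (volume.restrict (Ioc a b)) ∧
      HasFluxDerivOn a b v (fun z => f z + c * v z) := by
  have hba := sub_pos.2 hab
  have hc0 : 0 < c.re := by linarith
  have hfi := intervalIntegrable_of_memLp_two hab hf
  set h : ℝ → ℂ := fun t => Complex.exp (-c * travelTime a b t) * f t with hh
  have hnorm : ∀ x ∈ Ioo a b, ∀ t ∈ Ioo a b, x ≤ t →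
      ‖h t‖ ≤ Real.exp (-c.re * travelTime a b x) * ‖f t‖ := by
    intro x hx t ht hxt
    rw [hh, norm_mul, norm_cexp_mul_travelTime]
    refine mul_le_mul_of_nonneg_right (Real.exp_le_exp.2 ?_) (norm_nonneg _)
    have := mul_le_mul_of_nonneg_left (travelTime_monotoneOn hx ht hxt) hc0.le
    rw [Complex.neg_re]
    linarith
  have hae : ∀ᵐ t : ℝ, t ≠ b := by simp [ae_iff, measure_singleton]
  have hfx : ∀ x ∈ Ioo a b, IntervalIntegrable f volume x b := fun x hx => hfi.mono_set (by
    rw [uIcc_of_le hx.2.le, uIcc_of_le hab.le]; exact Icc_subset_Icc_left hx.1.le)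
  have hint : ∀ x ∈ Ioo a b, IntervalIntegrable h volume x b := by
    intro x hx
    refine ((hfx x hx).norm.const_mul (Real.exp (-c.re * travelTime a b x))).mono_fun' ?_ ?_
    · rw [uIoc_of_le hx.2.le]
      refine AEStronglyMeasurable.mul ?_ (hfx x hx).1.aestronglyMeasurable
      rw [← restrict_Ioo_eq_restrict_Ioc]
      refine ContinuousOn.aestronglyMeasurable (fun z hz => ?_) measurableSet_Ioo
      exact (hasDerivAt_cexp_travelTime (-c)
        ⟨hx.1.trans hz.1, hz.2⟩).continuousAt.continuousWithinAt
    · rw [uIoc_of_le hx.2.le]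
      filter_upwards [ae_restrict_mem measurableSet_Ioc, ae_restrict_of_ae hae] with t ht htb
      exact hnorm x hx t ⟨hx.1.trans ht.1, lt_of_le_of_ne ht.2 htb⟩ ht.1.le
  have hH : IsPrimitiveOn a b (fun z => -∫ t in z..b, h t) h := by
    intro x hx y hy
    have hxy := (hint x hx).trans (hint y hy).symm
    refine ⟨hxy, ?_⟩
    simp only
    rw [← intervalIntegral.integral_add_adjacent_intervals hxy (hint y hy)]
    ring
  set W : ℝ → ℂ := fun z => (-∫ t in z..b, h t) * Complex.exp (c * travelTime a b z) with hW
  set v : ℝ → ℂ := fun z => W z / weight a b z with hv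
  have hwv : ∀ z ∈ Ioo a b, (weight a b z : ℂ) * v z = W z := fun z hz => by
    have := Complex.ofReal_ne_zero.2 (weight_pos hz).ne'
    simp only [hv]
    field_simp
  have hflux : HasFluxDerivOn a b v (fun z => f z + c * v z) := by
    refine (hH.mul (isPrimitiveOn_cexp_travelTime c)).congr (fun z hz => (hwv z hz).symm)
      fun z hz => ?_
    have e : h z * Complex.exp (c * travelTime a b z) = f z := by
      simp only [hh]
      rw [mul_right_comm, ← Complex.exp_add]
      simp
    simp only
    rw [e]
    simp only [hv, hW]
    ring
  refine ⟨v, hflux.memLp_of_bound hab hc hf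
    (M := 4 / (b - a) * ∫ z in a..b, ‖f z‖ ^ 2) (fun z hz => ?_), hflux⟩
  have hzI : z ∈ Ioo a b := ⟨by linarith [hz.1], hz.2⟩
  have hbz := sub_pos.2 hz.2
  have hza : (b - a) / 2 ≤ z - a := by linarith [hz.1]
  have hw := weight_pos hzI
  have hWz : ‖W z‖ ≤ ∫ t in z..b, ‖f t‖ := by
    have h1 : ‖∫ t in z..b, h t‖ ≤
        ∫ t in z..b, Real.exp (-c.re * travelTime a b z) * ‖f t‖ := by
      refine intervalIntegral.norm_integral_le_of_norm_le hzI.2.le ?_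
        ((hfx z hzI).norm.const_mul _)
      filter_upwards [hae] with t htb ht
      exact hnorm z hzI t ⟨hzI.1.trans ht.1, lt_of_le_of_ne ht.2 htb⟩ ht.1.le
    rw [intervalIntegral.integral_const_mul] at h1
    simp only [hW]
    rw [norm_mul, norm_neg, norm_cexp_mul_travelTime]
    calc _ ≤ Real.exp (-c.re * travelTime a b z) * (∫ t in z..b, ‖f t‖) *
          Real.exp (c.re * travelTime a b z) := by gcongr
      _ = _ := by
        rw [mul_right_comm, ← Real.exp_add]
        simp
  have hcs := sq_integral_norm_le hz.2.le
    (hf.mono_measure (Measure.restrict_mono (Ioc_subset_Ioc_left hzI.1.le) le_rfl))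
  have hf2 : IntervalIntegrable (fun z => ‖f z‖ ^ 2) volume a b :=
    (intervalIntegrable_iff_integrableOn_Ioc_of_le hab.le).2 (hf.integrable_norm_pow (by norm_num))
  have hN : ∫ t in z..b, ‖f t‖ ^ 2 ≤ ∫ z in a..b, ‖f z‖ ^ 2 :=
    intervalIntegral.integral_mono_interval hzI.1.le hzI.2.le le_rfl
      (ae_of_all _ fun _ => by positivity) hf2
  have hW2 : ‖W z‖ ^ 2 ≤ (b - z) * ∫ z in a..b, ‖f z‖ ^ 2 := by
    refine (pow_le_pow_left₀ (norm_nonneg _) hWz 2).trans (hcs.trans ?_)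
    gcongr
  have hN0 : 0 ≤ ∫ z in a..b, ‖f z‖ ^ 2 :=
    intervalIntegral.integral_nonneg hab.le fun _ _ => by positivity
  have e : weight a b z * ‖v z‖ ^ 2 = ‖W z‖ ^ 2 / weight a b z := by
    simp only [hv]
    rw [norm_div, Complex.norm_real, Real.norm_of_nonneg hw.le]
    field_simp
  rw [e, div_le_iff₀ hw]
  refine hW2.trans ?_
  have : 1 ≤ 2 / (b - a) * (z - a) := by
    rw [div_mul_eq_mul_div, one_le_div hba]
    linarith
  calc (b - z) * ∫ z in a..b, ‖f z‖ ^ 2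
      ≤ (2 / (b - a) * (z - a)) * ((b - z) * ∫ z in a..b, ‖f z‖ ^ 2) :=
        le_mul_of_one_le_left (by positivity) this
    _ = _ := by
        unfold weight
        ring

lemma memLp_reflect (hf : MemLp f 2 (volume.restrict (Ioc a b))) :
    MemLp (fun z => f (a + b - z)) 2 (volume.restrict (Ioc a b)) := by
  rw [← restrict_Ioo_eq_restrict_Ioc] at hf ⊢
  have hm := (Measure.measurePreserving_sub_left volume (a + b)).restrict_preimage
    (s := Ioo a b) measurableSet_Ioo
  have : (fun z => a + b - z) ⁻¹' Ioo a b = Ioo a b := by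
    ext z
    simp only [mem_preimage, mem_Ioo]
    constructor <;> rintro ⟨h1, h2⟩ <;> constructor <;> linarith
  rw [this] at hm
  exact hf.comp_measurePreserving hm

/-- Solvability of `(w v)' - c v = f` outside the closed strip `|Re c| ≤ (b - a)/4`; the left half
plane is reduced to the right one by reflecting the interval. -/
lemma exists_hasFluxDerivOn (hab : a < b) {c : ℂ} (hc : (b - a) / 4 < |c.re|)
    (hf : MemLp f 2 (volume.restrict (Ioc a b))) :
    ∃ v : ℝ → ℂ, MemLp v 2 (volume.restrict (Ioc a b)) ∧
      HasFluxDerivOn a b v (fun z => f z + c * v z) := by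
  rcases lt_abs.1 hc with h | h
  · exact exists_hasFluxDerivOn_of_lt hab h hf
  · obtain ⟨v, hv, hflux⟩ := exists_hasFluxDerivOn_of_lt hab (c := -c) (by simpa using h)
      (memLp_reflect hf).neg
    refine ⟨fun z => v (a + b - z), memLp_reflect hv, ?_⟩
    refine (IsPrimitiveOn.reflect hflux).congr (fun z _ => ?_) fun z _ => ?_
    · simp only [weight_reflect]
    · simp only [Pi.neg_apply, sub_sub_cancel]
      ring

end Solve

/-! ### Weak derivatives of periodic functions and absolutely continuous representatives -/

lemma neg_pi_lt_pi : -π < π := by linarith [pi_pos]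

lemma _root_.Function.Periodic.apply_pi {φ : ℝ → ℂ} (hp : Function.Periodic φ (2 * π)) :
    φ π = φ (-π) := by
  rw [← hp (-π)]
  congr 1
  ring

lemma eq_add_integral_deriv {φ : ℝ → ℂ} (hφ : ContDiff ℝ (⊤ : ℕ∞) φ) (x y : ℝ) :
    φ y = φ x + ∫ t in x..y, deriv φ t := by
  rw [intervalIntegral.integral_deriv_eq_sub
    (fun t _ => (hφ.differentiable (by simp)).differentiableAt)
    ((hφ.continuous_deriv (by simp)).intervalIntegrable _ _)]
  ring

lemma hasWeakDeriv_const (C : ℂ) : HasWeakDeriv (fun _ => C) (fun _ => 0) := by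
  refine ⟨integrableOn_const (by simp), integrableOn_zero, fun φ hφ hp => ?_⟩
  have h := eq_add_integral_deriv hφ (-π) π
  rw [hp.apply_pi] at h
  have h' : ∫ t in (-π)..π, deriv φ t = 0 := by linear_combination -h
  rw [intervalIntegral.integral_const_mul, h']
  simp

lemma HasWeakDeriv.sub {f₁ f₂ g₁ g₂ : ℝ → ℂ} (h₁ : HasWeakDeriv f₁ g₁)
    (h₂ : HasWeakDeriv f₂ g₂) :
    HasWeakDeriv (fun z => f₁ z - f₂ z) (fun z => g₁ z - g₂ z) := by
  have := h₁.add (h₂.const_mul (-1))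
  simpa [← sub_eq_add_neg] using this

/-- The weak derivative has mean zero: test against the constant function. -/
lemma HasWeakDeriv.integral_eq_zero {f g : ℝ → ℂ} (h : HasWeakDeriv f g) :
    ∫ z in (-π)..π, g z = 0 := by
  have := h.2.2 (fun _ => 1) contDiff_const (fun _ => rfl)
  simpa using this

lemma hasWeakDeriv_primitive {g : ℝ → ℂ} (hg : IntegrableOn g (Ioc (-π) π))
    (h0 : ∫ z in (-π)..π, g z = 0) : HasWeakDeriv (fun z => ∫ t in (-π)..z, g t) g := by
  have hgi := (intervalIntegrable_iff_integrableOn_Ioc_of_le neg_pi_le_pi).2 hg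
  have hc := intervalIntegral.continuousOn_primitive_interval' hgi left_mem_uIcc
  have hGi : IntervalIntegrable (fun z => ∫ t in (-π)..z, g t) volume (-π) π :=
    hc.intervalIntegrable
  refine ⟨(intervalIntegrable_iff_integrableOn_Ioc_of_le neg_pi_le_pi).1 hGi, hg,
    fun φ hφ hp => ?_⟩
  have hφ' : Continuous (deriv φ) := hφ.continuous_deriv (by simp)
  have hp := (integral_mul_add_mul_of_primitive (F := fun z => ∫ t in (-π)..z, g t)
    (G := φ) hgi
    (hφ'.intervalIntegrable (-π) π) (fun t _ => by simp)
    (fun t _ => eq_add_integral_deriv hφ _ _)).2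
  rw [intervalIntegral.integral_add (hgi.mul_continuousOn hφ.continuous.continuousOn)
    (hGi.mul_continuousOn hφ'.continuousOn), h0] at hp
  simp only [intervalIntegral.integral_same, zero_mul, sub_zero] at hp
  linear_combination hp

/-- A square-integrable periodic function with vanishing weak derivative is constant, by Fourier
series. -/
lemma HasWeakDeriv.ae_eq_const {h : ℝ → ℂ} (hmem : MemLp h 2 (volume.restrict (Ioc (-π) π)))
    (h0 : HasWeakDeriv h (fun _ => 0)) :
    ∃ C : ℂ, h =ᵐ[volume.restrict (Ioc (-π) π)] fun _ => C := by
  set C : ℂ := (1 / (2 * π) : ℝ) * ∫ z in (-π)..π, h z with hC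
  refine ⟨C, ?_⟩
  set u : ℝ → ℂ := fun z => h z - C with hu
  have hu0 : HasWeakDeriv u (fun _ => 0) := by
    simpa using h0.sub (hasWeakDeriv_const C)
  have humem : MemLp u 2 (volume.restrict (Ioc (-π) π)) := hmem.sub (memLp_const C)
  have hint : ∫ z in (-π)..π, u z = 0 := by
    have hi := (intervalIntegrable_iff_integrableOn_Ioc_of_le neg_pi_le_pi).2 h0.1
    simp only [hu]
    rw [intervalIntegral.integral_sub hi (by simp), intervalIntegral.integral_const, hC,
      Complex.real_smul, ← mul_assoc, ← Complex.ofReal_mul]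
    have : (π - -π) * (1 / (2 * π)) = 1 := by
      have := pi_pos.ne'
      field_simp
      ring
    rw [this]
    simp
  -- `e^{kz}` is `1/k` times its derivative, so every nonzero Fourier mode of `u` vanishes
  have hcoef : ∀ n : ℤ, fourierCoeffOn neg_pi_lt_pi u n = 0 := by
    intro n
    rw [fourierCoeffOn_eq_integral]
    rcases eq_or_ne n 0 with rfl | hn
    · simp [hint]
    set k : ℂ := 2 * π * Complex.I * (-n : ℤ) / ((π - -π : ℝ) : ℂ) with hk
    have hk0 : k ≠ 0 := by
      have h1 : ((π - -π : ℝ) : ℂ) ≠ 0 := Complex.ofReal_ne_zero.2 (by linarith [pi_pos])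
      have h2 : (π : ℂ) ≠ 0 := Complex.ofReal_ne_zero.2 pi_pos.ne'
      refine div_ne_zero ?_ h1
      simp [h2, hn]
    have e : ∀ z : ℝ, fourier (-n) (z : AddCircle (π - -π)) = Complex.exp (k * z) := by
      intro z
      rw [fourier_coe_apply, hk]
      congr 1
      ring
    have hd : ∀ z : ℝ, deriv (fun z : ℝ => Complex.exp (k * z)) z = Complex.exp (k * z) * k := by
      intro z
      have := ((hasDerivAt_id z).ofReal_comp.const_mul k).cexp
      simpa using this.deriv
    have htest := hu0.2.2 (fun z => Complex.exp (k * z)) (by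
        have h : ContDiff ℝ (⊤ : ℕ∞) (fun x : ℝ => (x : ℂ)) := Complex.ofRealCLM.contDiff
        exact (contDiff_const.mul h).cexp) (by
      intro z
      simp only [← e]
      have : ((z + 2 * π : ℝ) : AddCircle (π - -π)) = (z : AddCircle (π - -π)) := by
        have e : 2 * π = π - -π := by ring
        rw [e]
        exact AddCircle.coe_add_period _ z
      rw [this])
    simp only [hd, zero_mul, intervalIntegral.integral_zero, neg_zero, ← mul_assoc] at htest
    rw [intervalIntegral.integral_mul_const] at htest
    have := (mul_eq_zero.1 htest).resolve_right hk0
    simp only [e, smul_eq_mul]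
    simp only [mul_comm (Complex.exp _)]
    rw [this, smul_zero]
  have hsum := hasSum_sq_fourierCoeffOn neg_pi_lt_pi humem
  simp only [hcoef, norm_zero, ne_eq, OfNat.ofNat_ne_zero, not_false_eq_true, zero_pow] at hsum
  have hz := hsum.unique hasSum_zero
  have hz' : ∫ z in Ioc (-π) π, ‖u z‖ ^ 2 = 0 := by
    rw [← intervalIntegral.integral_of_le neg_pi_le_pi]
    exact (smul_eq_zero.1 hz).resolve_left (inv_ne_zero (by linarith [pi_pos]))
  have hae := (integral_eq_zero_iff_of_nonneg (fun z => by positivity)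
    (humem.integrable_norm_pow (by norm_num))).1 hz'
  filter_upwards [hae] with z hz
  have : ‖u z‖ = 0 := by simpa using hz
  exact sub_eq_zero.1 (norm_eq_zero.1 this)

/-- A square-integrable function with weak derivative `g` agrees almost everywhere with a primitive
of `g`. -/
lemma HasWeakDeriv.exists_primitive {f g : ℝ → ℂ}
    (hmem : MemLp f 2 (volume.restrict (Ioc (-π) π))) (h : HasWeakDeriv f g) :
    ∃ C : ℂ, f =ᵐ[volume.restrict (Ioc (-π) π)] fun z => C + ∫ t in (-π)..z, g t := by
  have hgi := (intervalIntegrable_iff_integrableOn_Ioc_of_le neg_pi_le_pi).2 h.2.1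
  have hc := intervalIntegral.continuousOn_primitive_interval' hgi left_mem_uIcc
  rw [uIcc_of_le neg_pi_le_pi] at hc
  have hG : MemLp (fun z => ∫ t in (-π)..z, g t) 2 (volume.restrict (Ioc (-π) π)) := by
    obtain ⟨C, hC⟩ := isCompact_Icc.exists_bound_of_continuousOn hc
    refine MemLp.of_bound
      ((hc.mono Ioc_subset_Icc_self).aestronglyMeasurable measurableSet_Ioc) C ?_
    filter_upwards [ae_restrict_mem measurableSet_Ioc] with z hz
    exact hC z (Ioc_subset_Icc_self hz)
  have h0 := h.sub (hasWeakDeriv_primitive h.2.1 h.integral_eq_zero)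
  simp only [sub_self] at h0
  obtain ⟨C, hC⟩ := h0.ae_eq_const (hmem.sub hG)
  refine ⟨C, ?_⟩
  filter_upwards [hC] with z hz
  rw [← hz, Pi.sub_apply]
  ring

/-! ### The coefficient of the linearized operator -/

/-- The product `(c_* - U_*²) v` at the peaked wave. -/
abbrev peakedFlux (v : ℝ → ℂ) : ℝ → ℂ := flux 2 peakedSpeed peakedWave v

lemma peakedSpeed_sub_sq {z : ℝ} (hz : z ∈ Icc (-π) π) :
    peakedSpeed - peakedWave z ^ 2 = |z| * (π - |z|) / 2 := by
  rw [peakedWave_eq hz, peakedSpeed, div_pow, Real.sq_sqrt (by norm_num)]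
  ring

lemma peakedFlux_left (v : ℝ → ℂ) {z : ℝ} (hz : z ∈ Icc (-π) 0) :
    peakedFlux v z = (weight (-π) 0 z : ℂ) * v z := by
  have h := peakedSpeed_sub_sq (z := z) ⟨hz.1, hz.2.trans pi_pos.le⟩
  simp only [flux]
  rw [h, abs_of_nonpos hz.2, weight]
  congr 2
  ring

lemma peakedFlux_right (v : ℝ → ℂ) {z : ℝ} (hz : z ∈ Icc 0 π) :
    peakedFlux v z = (weight 0 π z : ℂ) * v z := by
  have h := peakedSpeed_sub_sq (z := z) ⟨(neg_nonpos.2 pi_pos.le).trans hz.1, hz.2⟩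
  simp only [flux]
  rw [h, abs_of_nonneg hz.1, weight]
  congr 2
  ring

lemma restrict_left_le : volume.restrict (Ioc (-π) 0) ≤ volume.restrict (Ioc (-π) π) :=
  Measure.restrict_mono (Ioc_subset_Ioc_right pi_pos.le) le_rfl

lemma restrict_right_le : volume.restrict (Ioc 0 π) ≤ volume.restrict (Ioc (-π) π) :=
  Measure.restrict_mono (Ioc_subset_Ioc_left (by linarith [pi_pos])) le_rfl

lemma memLp_peakedFlux (v : L2per) : MemLp (peakedFlux v) 2 (volume.restrict (Ioc (-π) π)) := by
  have e : (fun z => ((|z| * (π - |z|) / 2 : ℝ) : ℂ) * v z)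
      =ᵐ[volume.restrict (Ioc (-π) π)] peakedFlux v := by
    filter_upwards [ae_restrict_mem measurableSet_Ioc] with z hz
    simp only [flux]
    rw [peakedSpeed_sub_sq (Ioc_subset_Icc_self hz)]
  refine (MemLp.of_le_mul (c := π ^ 2) (Lp.memLp v) ?_ ?_).ae_eq e
  · exact (Continuous.aestronglyMeasurable (by fun_prop)).mul (Lp.aestronglyMeasurable v)
  · filter_upwards [ae_restrict_mem measurableSet_Ioc] with z hz
    rw [norm_mul, Complex.norm_real]
    refine mul_le_mul_of_nonneg_right ?_ (norm_nonneg _)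
    have h1 : |z| ≤ π := abs_le.2 ⟨hz.1.le, hz.2⟩
    have h2 := abs_nonneg z
    have h3 := mul_nonneg h2 (sub_nonneg.2 h1)
    rw [Real.norm_eq_abs, abs_of_nonneg (by linarith)]
    nlinarith [pi_pos]

/-! ### The transport operator and its quadratic form -/

lemma ae_left_of_ae {p : ℝ → Prop} (h : ∀ᵐ z ∂volume.restrict (Ioc (-π) π), p z) :
    ∀ᵐ z ∂volume.restrict (Ioc (-π) 0), p z :=
  ae_mono restrict_left_le h

lemma ae_right_of_ae {p : ℝ → Prop} (h : ∀ᵐ z ∂volume.restrict (Ioc (-π) π), p z) :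
    ∀ᵐ z ∂volume.restrict (Ioc 0 π), p z :=
  ae_mono restrict_right_le h

lemma ae_of_ae_left_right {p : ℝ → Prop} (h₁ : ∀ᵐ z ∂volume.restrict (Ioc (-π) 0), p z)
    (h₂ : ∀ᵐ z ∂volume.restrict (Ioc 0 π), p z) : ∀ᵐ z ∂volume.restrict (Ioc (-π) π), p z := by
  rw [← Ioc_union_Ioc_eq_Ioc (neg_nonpos.2 pi_pos.le) pi_pos.le, ae_restrict_union_iff]
  exact ⟨h₁, h₂⟩

lemma isPrimitiveOn_integral {a b : ℝ} {g : ℝ → ℂ} (hg : IntervalIntegrable g volume (-π) π)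
    (hab : Ioo a b ⊆ Icc (-π) π) (C : ℂ) :
    IsPrimitiveOn a b (fun z => C + ∫ t in (-π)..z, g t) g := by
  intro x hx y hy
  have h1 : ∀ z ∈ Ioo a b, IntervalIntegrable g volume (-π) z := fun z hz => hg.mono_set (by
    rw [uIcc_of_le (hab hz).1, uIcc_of_le neg_pi_le_pi]
    exact Icc_subset_Icc_right (hab hz).2)
  refine ⟨(h1 x hx).symm.trans (h1 y hy), ?_⟩
  rw [← intervalIntegral.integral_interval_sub_left (h1 y hy) (h1 x hx)]
  ring

/-- A weak solution of `∂_z[(c_* - U_*²) v] = g` has a representative solving the equation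
classically on each half-period. -/
lemma exists_hasFluxDerivOn_of_hasWeakDeriv {v : L2per} {g : ℝ → ℂ}
    (h : HasWeakDeriv (peakedFlux v) g) :
    ∃ u : ℝ → ℂ, (v : ℝ → ℂ) =ᵐ[volume.restrict (Ioc (-π) π)] u ∧
      HasFluxDerivOn (-π) 0 u g ∧ HasFluxDerivOn 0 π u g := by
  obtain ⟨C, hC⟩ := h.exists_primitive (memLp_peakedFlux v)
  have hgi := (intervalIntegrable_iff_integrableOn_Ioc_of_le neg_pi_le_pi).2 h.2.1
  have hπ := pi_pos
  set W : ℝ → ℂ := fun z => C + ∫ t in (-π)..z, g t with hW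
  -- dividing by zero at the ends of the half-periods affects a null set only
  set u : ℝ → ℂ := fun z => W z / (|z| * (π - |z|) / 2 : ℝ) with hu
  have hq : ∀ z ∈ Ioc (-π) π, peakedFlux v z = ((|z| * (π - |z|) / 2 : ℝ) : ℂ) * v z := by
    intro z hz
    simp only [flux]
    rw [peakedSpeed_sub_sq (Ioc_subset_Icc_self hz)]
  refine ⟨u, ?_, ?_, ?_⟩
  · have hne : ∀ c : ℝ, ∀ᵐ z ∂volume.restrict (Ioc (-π) π), z ≠ c := fun c =>
      ae_restrict_of_ae (by simp [ae_iff, measure_singleton])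
    filter_upwards [hC, ae_restrict_mem measurableSet_Ioc, hne 0, hne π] with z h1 hz h0 hπz
    have hpos : (0 : ℝ) < |z| * (π - |z|) / 2 := by
      have h1 : |z| < π := abs_lt.2 ⟨hz.1, lt_of_le_of_ne hz.2 hπz⟩
      have := mul_pos (abs_pos.2 h0) (sub_pos.2 h1)
      linarith
    have hne := Complex.ofReal_ne_zero.2 hpos.ne'
    rw [hq z hz] at h1
    simp only [hu]
    rw [← h1]
    field_simp
  · refine (isPrimitiveOn_integral hgi (fun z hz => ⟨hz.1.le, hz.2.le.trans hπ.le⟩) C).congr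
      (fun z hz => ?_) fun z _ => rfl
    have hne := Complex.ofReal_ne_zero.2 (weight_pos hz).ne'
    have e : |z| * (π - |z|) / 2 = weight (-π) 0 z := by
      rw [abs_of_neg hz.2, weight]
      ring
    simp only [hu]
    rw [e]
    field_simp
    rfl
  · refine (isPrimitiveOn_integral hgi (fun z hz => ⟨by linarith [hz.1], hz.2.le⟩) C).congr
      (fun z hz => ?_) fun z _ => rfl
    have hne := Complex.ofReal_ne_zero.2 (weight_pos hz).ne'
    have e : |z| * (π - |z|) / 2 = weight 0 π z := by
      rw [abs_of_pos hz.1, weight]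
      ring
    simp only [hu]
    rw [e]
    field_simp
    rfl

/-- Testing a classical solution on a half-period against a smooth function produces no boundary
terms. -/
lemma HasFluxDerivOn.integral_add_eq_zero {a b : ℝ} (hab : a < b) {v g φ : ℝ → ℂ}
    (h : HasFluxDerivOn a b v g) (hv : MemLp v 2 (volume.restrict (Ioc a b)))
    (hg : MemLp g 2 (volume.restrict (Ioc a b))) (hφ : ContDiff ℝ (⊤ : ℕ∞) φ) :
    ∫ z in a..b, (g z * φ z + (weight a b z : ℂ) * v z * deriv φ z) = 0 := by
  have hφ' : Continuous (deriv φ) := hφ.continuous_deriv (by simp)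
  have hvi := intervalIntegrable_of_memLp_two hab hv
  have hgi := intervalIntegrable_of_memLp_two hab hg
  have hφp : IsPrimitiveOn a b φ (deriv φ) := isPrimitiveOn_of_hasDerivAt
    (fun z _ => (hφ.differentiable (by simp)).differentiableAt.hasDerivAt) hφ'.continuousOn
  have hw : Continuous fun z => (weight a b z : ℂ) :=
    Complex.continuous_ofReal.comp continuous_weight
  exact (IsPrimitiveOn.mul h hφp).integral_eq_zero hab
    ((hgi.mul_continuousOn hφ.continuous.continuousOn).add
      ((hvi.continuousOn_mul hw.continuousOn).mul_continuousOn hφ'.continuousOn))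
    (intervalIntegrable_weight_mul_div hab (hvi.mul_continuousOn hφ.continuous.continuousOn))

/-- Classical solutions on the two half-periods glue to a weak solution on the circle. -/
lemma hasWeakDeriv_of_hasFluxDerivOn {v : L2per} {u₁ u₂ g : ℝ → ℂ}
    (hu₁ : (v : ℝ → ℂ) =ᵐ[volume.restrict (Ioc (-π) 0)] u₁)
    (hu₂ : (v : ℝ → ℂ) =ᵐ[volume.restrict (Ioc 0 π)] u₂)
    (hg : MemLp g 2 (volume.restrict (Ioc (-π) π)))
    (hl : HasFluxDerivOn (-π) 0 u₁ g) (hr : HasFluxDerivOn 0 π u₂ g) :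
    HasWeakDeriv (peakedFlux v) g := by
  have hint : IntegrableOn (peakedFlux v) (Ioc (-π) π) :=
    (memLp_peakedFlux v).integrable (by norm_num)
  have hgint : IntegrableOn g (Ioc (-π) π) := hg.integrable (by norm_num)
  refine ⟨hint, hgint, fun φ hφ _ => ?_⟩
  have hφ' : Continuous (deriv φ) := hφ.continuous_deriv (by simp)
  have i1 := intervalIntegrable_mul_of_continuous hgint hφ.continuous
  have i2 := intervalIntegrable_mul_of_continuous hint hφ'
  rw [eq_neg_iff_add_eq_zero, add_comm, ← intervalIntegral.integral_add i1 i2,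
    ← intervalIntegral.integral_add_adjacent_intervals (b := 0)
      ((i1.add i2).mono_set ?_) ((i1.add i2).mono_set ?_)]
  · have h1 := hl.integral_add_eq_zero (by linarith [pi_pos])
      (((Lp.memLp v).mono_measure restrict_left_le).ae_eq hu₁)
      (hg.mono_measure restrict_left_le) hφ
    have h2 := hr.integral_add_eq_zero pi_pos
      (((Lp.memLp v).mono_measure restrict_right_le).ae_eq hu₂)
      (hg.mono_measure restrict_right_le) hφ
    have e1 : ∫ z in (-π)..0, (g z * φ z + peakedFlux v z * deriv φ z) = 0 := by
      rw [← h1]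
      refine intervalIntegral.integral_congr_ae_restrict ?_
      rw [uIoc_of_le (by linarith [pi_pos])]
      filter_upwards [hu₁, ae_restrict_mem measurableSet_Ioc] with z hz hzm
      rw [peakedFlux_left _ (Ioc_subset_Icc_self hzm), hz]
    have e2 : ∫ z in (0 : ℝ)..π, (g z * φ z + peakedFlux v z * deriv φ z) = 0 := by
      rw [← h2]
      refine intervalIntegral.integral_congr_ae_restrict ?_
      rw [uIoc_of_le pi_pos.le]
      filter_upwards [hu₂, ae_restrict_mem measurableSet_Ioc] with z hz hzm
      rw [peakedFlux_right _ (Ioc_subset_Icc_self hzm), hz]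
    rw [e1, e2, add_zero]
  · rw [uIcc_of_le (by linarith [pi_pos]), uIcc_of_le neg_pi_le_pi]
    exact Icc_subset_Icc_right pi_pos.le
  · rw [uIcc_of_le pi_pos.le, uIcc_of_le neg_pi_le_pi]
    exact Icc_subset_Icc_left (by linarith [pi_pos])

lemma inner_L2per (f g : L2per) : inner ℂ f g = ∫ z in (-π)..π, g z * conj (f z) := by
  rw [L2.inner_def, intervalIntegral.integral_of_le neg_pi_le_pi]
  rfl

lemma norm_sq_L2per (f : L2per) : ‖f‖ ^ 2 = ∫ z in (-π)..π, ‖f z‖ ^ 2 := by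
  have h : (inner ℂ f f : ℂ) = ((∫ z in (-π)..π, ‖f z‖ ^ 2 : ℝ) : ℂ) := by
    rw [inner_L2per, ← intervalIntegral.integral_ofReal]
    congr 1
    ext z
    rw [Complex.mul_conj']
    push_cast
    rfl
  rw [inner_self_eq_norm_sq_to_K] at h
  exact Complex.ofReal_injective (by rw [← h]; push_cast; rfl)

lemma intervalIntegral_split {E : Type*} [NormedAddCommGroup E] [NormedSpace ℝ E] {f : ℝ → E}
    (hf : IntervalIntegrable f volume (-π) π) :
    (∫ z in (-π)..0, f z) + (∫ z in (0 : ℝ)..π, f z) = ∫ z in (-π)..π, f z := by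
  refine intervalIntegral.integral_add_adjacent_intervals (hf.mono_set ?_) (hf.mono_set ?_)
  · rw [uIcc_of_le (by linarith [pi_pos]), uIcc_of_le neg_pi_le_pi]
    exact Icc_subset_Icc_right pi_pos.le
  · rw [uIcc_of_le pi_pos.le, uIcc_of_le neg_pi_le_pi]
    exact Icc_subset_Icc_left (by linarith [pi_pos])

/-- The quadratic form of `v ↦ ∂_z[(c_* - U_*²) v]` is bounded by `π/4`. -/
lemma abs_re_inner_fluxDeriv_le {v g : L2per} (h : HasWeakDeriv (peakedFlux v) g) :
    |(inner ℂ v g : ℂ).re| ≤ π / 4 * ‖v‖ ^ 2 := by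
  obtain ⟨u, hu, hl, hr⟩ := exists_hasFluxDerivOn_of_hasWeakDeriv h
  have hum : MemLp u 2 (volume.restrict (Ioc (-π) π)) := (Lp.memLp v).ae_eq hu
  have hgm := Lp.memLp g
  have h1 := hl.abs_re_integral_le (by linarith [pi_pos]) (hum.mono_measure restrict_left_le)
    (hgm.mono_measure restrict_left_le)
  have h2 := hr.abs_re_integral_le pi_pos (hum.mono_measure restrict_right_le)
    (hgm.mono_measure restrict_right_le)
  have e1 : (inner ℂ v g : ℂ) = ∫ z in (-π)..π, g z * conj (u z) := by
    rw [inner_L2per]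
    refine intervalIntegral.integral_congr_ae_restrict ?_
    rw [uIoc_of_le neg_pi_le_pi]
    filter_upwards [hu] with z hz
    rw [hz]
  have e2 : ‖v‖ ^ 2 = ∫ z in (-π)..π, ‖u z‖ ^ 2 := by
    rw [norm_sq_L2per]
    refine intervalIntegral.integral_congr_ae_restrict ?_
    rw [uIoc_of_le neg_pi_le_pi]
    filter_upwards [hu] with z hz
    rw [hz]
  have i1 := intervalIntegrable_mul_of_memLp_two neg_pi_lt_pi hgm (memLp_two_conj hum)
  have i2 : IntervalIntegrable (fun z => ‖u z‖ ^ 2) volume (-π) π :=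
    (intervalIntegrable_iff_integrableOn_Ioc_of_le neg_pi_le_pi).2
      (hum.integrable_norm_pow (by norm_num))
  rw [e1, e2, ← intervalIntegral_split i1, ← intervalIntegral_split i2, Complex.add_re]
  refine (abs_add_le _ _).trans ?_
  simp only [zero_sub, neg_neg, sub_zero] at h1 h2
  linarith

/-- `∂_z⁻¹` is skew-adjoint: `2 Re (v V̄) = (|V|²)'` for the periodic antiderivative `V` of `v`. -/
lemma re_inner_invDeriv (v : dotL2per) : (inner ℂ v (invDeriv v) : ℂ).re = 0 := by
  have hV : ((invDeriv v : L2per) : ℝ → ℂ) =ᵐ[volume.restrict (Ioc (-π) π)]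
      antideriv (v : L2per) := (memLp_antideriv (v : L2per)).coeFn_toLp
  set V := antideriv (v : L2per) with hVdef
  have hv : ∫ z in (-π)..π, (v : L2per) z = 0 := v.2
  have hvm := Lp.memLp (v : L2per)
  have hVm := memLp_antideriv (v : L2per)
  have hvi := intervalIntegrable_L2per (v : L2per)
  have hprim : ∀ t, V t = V (-π) + ∫ s in (-π)..t, (v : L2per) s := by
    intro t
    simp only [hVdef, antideriv, intervalIntegral.integral_same]
    ring
  have hend : V π = V (-π) := by rw [hprim π, hv, add_zero]
  have hci : IntervalIntegrable (fun t => conj ((v : L2per) t)) volume (-π) π :=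
    intervalIntegrable_of_memLp_two neg_pi_lt_pi (memLp_two_conj hvm)
  have h := (integral_mul_add_mul_of_primitive (F := V) (G := fun t => conj (V t)) hvi hci
    (fun t _ => hprim t) (fun t _ => by
      rw [hprim t, map_add, intervalIntegral, intervalIntegral, map_sub, integral_conj,
        integral_conj])).2
  rw [hend, sub_self, intervalIntegral.integral_add
    (intervalIntegrable_mul_of_memLp_two neg_pi_lt_pi hvm (memLp_two_conj hVm))
    (intervalIntegrable_mul_of_memLp_two neg_pi_lt_pi hVm (memLp_two_conj hvm))] at h
  have hconj : ∫ z in (-π)..π, (v : L2per) z * conj (V z) =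
      conj (∫ z in (-π)..π, V z * conj ((v : L2per) z)) := by
    rw [intervalIntegral.integral_of_le neg_pi_le_pi, intervalIntegral.integral_of_le neg_pi_le_pi,
      ← integral_conj]
    congr 1
    ext z
    simp [mul_comm]
  have e1 : (inner ℂ v (invDeriv v) : ℂ) = ∫ z in (-π)..π, V z * conj ((v : L2per) z) := by
    rw [Submodule.coe_inner, inner_L2per]
    refine intervalIntegral.integral_congr_ae_restrict ?_
    rw [uIoc_of_le neg_pi_le_pi]
    filter_upwards [hV] with z hz
    rw [hz]
  rw [hconj, add_comm, Complex.add_conj] at h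
  rw [e1]
  have := Complex.ofReal_eq_zero.1 h
  linarith

/-- The transport part `v ↦ ∂_z[(c - U^p) v]` of the linearized operator. -/
def fluxOperator (p : ℕ) (c : ℝ) (U : ℝ → ℝ) : dotL2per →ₗ.[ℂ] dotL2per where
  domain := maxDomain p c U
  toFun :=
    { toFun := fluxDeriv p c U
      map_add' := fun v w => fluxDeriv_eq p c U (v + w)
        (hasWeakDeriv_flux_add p c U (fluxDeriv_spec p c U v) (fluxDeriv_spec p c U w))
      map_smul' := fun a v => fluxDeriv_eq p c U (a • v)
        (hasWeakDeriv_flux_smul p c U a (fluxDeriv_spec p c U v)) }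

/-- The transport part of the linearized operator at the peaked wave. -/
abbrev peakedTransport : dotL2per →ₗ.[ℂ] dotL2per := fluxOperator 2 peakedSpeed peakedWave

/-- The linearized operator at the peaked wave. -/
abbrev peakedLinearization : dotL2per →ₗ.[ℂ] dotL2per :=
  linearizedOperator 2 peakedSpeed peakedWave

/-- An operator whose quadratic form has real part at most `π/4` is bounded below outside the
strip. -/
lemma sub_mul_norm_le_of_abs_re_inner_le {X : Type*} [NormedAddCommGroup X]
    [InnerProductSpace ℂ X] {v w : X} {c : ℂ} (h : |(inner ℂ v w : ℂ).re| ≤ π / 4 * ‖v‖ ^ 2) :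
    (|c.re| - π / 4) * ‖v‖ ≤ ‖w - c • v‖ := by
  have e : (inner ℂ v (w - c • v) : ℂ).re = (inner ℂ v w : ℂ).re - c.re * ‖v‖ ^ 2 := by
    rw [inner_sub_right, inner_smul_right (𝕜 := ℂ), inner_self_eq_norm_sq_to_K]
    simp [← Complex.ofReal_pow]
  have h1 : |(inner ℂ v (w - c • v) : ℂ).re| ≤ ‖v‖ * ‖w - c • v‖ :=
    (Complex.abs_re_le_norm _).trans (norm_inner_le_norm (𝕜 := ℂ) _ _)
  have h2 : |c.re| * ‖v‖ ^ 2 ≤ |(inner ℂ v (w - c • v) : ℂ).re| + |(inner ℂ v w : ℂ).re| := by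
    have : c.re * ‖v‖ ^ 2 = (inner ℂ v w : ℂ).re - (inner ℂ v (w - c • v) : ℂ).re := by
      rw [e]
      ring
    rw [← abs_of_nonneg (sq_nonneg ‖v‖), ← abs_mul, this, add_comm]
    exact abs_sub _ _
  rcases (norm_nonneg v).eq_or_lt with h0 | h0
  · rw [← h0, mul_zero]
    exact norm_nonneg _
  · have : (|c.re| - π / 4) * ‖v‖ * ‖v‖ ≤ ‖w - c • v‖ * ‖v‖ := by nlinarith
    exact le_of_mul_le_mul_right this h0

lemma abs_re_inner_peakedTransport_le (v : peakedTransport.domain) :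
    |(inner ℂ (v : dotL2per) (peakedTransport v) : ℂ).re| ≤ π / 4 * ‖(v : dotL2per)‖ ^ 2 :=
  abs_re_inner_fluxDeriv_le (fluxDeriv_spec 2 peakedSpeed peakedWave v)

lemma abs_re_inner_peakedLinearization_le (v : peakedLinearization.domain) :
    |(inner ℂ (v : dotL2per) (peakedLinearization v) : ℂ).re| ≤
      π / 4 * ‖(v : dotL2per)‖ ^ 2 := by
  have e : peakedLinearization v =
      fluxDeriv 2 peakedSpeed peakedWave v + invDeriv (v : dotL2per) := rfl
  rw [e, inner_add_right, Complex.add_re, re_inner_invDeriv, add_zero]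
  exact abs_re_inner_fluxDeriv_le (fluxDeriv_spec 2 peakedSpeed peakedWave v)

lemma eq_zero_of_sub_smul_eq_zero {X : Type*} [NormedAddCommGroup X] [InnerProductSpace ℂ X]
    {v w : X} {c : ℂ} (hc : π / 4 < |c.re|)
    (h : |(inner ℂ v w : ℂ).re| ≤ π / 4 * ‖v‖ ^ 2) (h0 : w - c • v = 0) : v = 0 := by
  have := sub_mul_norm_le_of_abs_re_inner_le (c := c) h
  rw [h0, norm_zero] at this
  have h1 : ‖v‖ ≤ 0 := nonpos_of_mul_nonpos_right this (by linarith)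
  exact norm_le_zero_iff.1 h1

/-! ### Compactness of the antiderivative -/

lemma norm_integral_L2per_le (v : L2per) {x y : ℝ} (hx : -π ≤ x) (hxy : x ≤ y) (hy : y ≤ π) :
    ‖∫ t in x..y, v t‖ ≤ √(y - x) * ‖v‖ := by
  have hle : volume.restrict (Ioc x y) ≤ volume.restrict (Ioc (-π) π) :=
    Measure.restrict_mono (Ioc_subset_Ioc hx hy) le_rfl
  have h1 := sq_integral_norm_le hxy ((Lp.memLp v).mono_measure hle)
  have h2 : IntervalIntegrable (fun z => ‖v z‖ ^ 2) volume (-π) π :=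
    (intervalIntegrable_iff_integrableOn_Ioc_of_le neg_pi_le_pi).2
      ((Lp.memLp v).integrable_norm_pow (by norm_num))
  have h3 : ∫ t in x..y, ‖v t‖ ^ 2 ≤ ‖v‖ ^ 2 := by
    rw [norm_sq_L2per]
    exact intervalIntegral.integral_mono_interval hx hxy hy (ae_of_all _ fun _ => by positivity) h2
  have h4 : (∫ t in x..y, ‖v t‖) ^ 2 ≤ (√(y - x) * ‖v‖) ^ 2 := by
    rw [mul_pow, Real.sq_sqrt (sub_nonneg.2 hxy)]
    exact h1.trans (mul_le_mul_of_nonneg_left h3 (sub_nonneg.2 hxy))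
  exact (intervalIntegral.norm_integral_le_integral_norm hxy).trans
    (le_of_sq_le_sq h4 (by positivity))

/-- The antiderivative of an `L²` function is Hölder continuous with exponent `1/2`. -/
lemma norm_antideriv_sub_le (v : L2per) {x y : ℝ} (hx : -π ≤ x) (hxy : x ≤ y) (hy : y ≤ π) :
    ‖antideriv v y - antideriv v x‖ ≤ √(y - x) * ‖v‖ := by
  have e : antideriv v y - antideriv v x = ∫ t in x..y, v t := by
    rw [← intervalIntegral.integral_interval_sub_left
      (intervalIntegrable_L2per_of_mem v ⟨hx.trans hxy, hy⟩)
      (intervalIntegrable_L2per_of_mem v ⟨hx, hxy.trans hy⟩)]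
    simp only [antideriv]
    ring
  rw [e]
  exact norm_integral_L2per_le v hx hxy hy

lemma norm_antideriv_le (v : L2per) {z : ℝ} (hz : z ∈ Icc (-π) π) :
    ‖antideriv v z‖ ≤ 2 * √(2 * π) * ‖v‖ := by
  have h : ∀ s ∈ Icc (-π) π, ‖∫ t in (-π)..s, v t‖ ≤ √(2 * π) * ‖v‖ := fun s hs => by
    refine (norm_integral_L2per_le v le_rfl hs.1 hs.2).trans ?_
    gcongr
    linarith [hs.2]
  have h2 : ‖∫ s in (-π)..π, ∫ t in (-π)..s, v t‖ ≤ √(2 * π) * ‖v‖ * |π - -π| :=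
    intervalIntegral.norm_integral_le_of_norm_le_const fun s hs => by
      rw [uIoc_of_le neg_pi_le_pi] at hs
      exact h s (Ioc_subset_Icc_self hs)
  have hπ := pi_pos
  have h3 : ‖((1 / (2 * π) : ℝ) : ℂ) * ∫ s in (-π)..π, ∫ t in (-π)..s, v t‖ ≤
      √(2 * π) * ‖v‖ := by
    rw [norm_mul, Complex.norm_real, Real.norm_of_nonneg (by positivity)]
    rw [abs_of_nonneg (by linarith)] at h2
    calc _ ≤ 1 / (2 * π) * (√(2 * π) * ‖v‖ * (π - -π)) := by gcongr
      _ = _ := by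
        field_simp
        ring
  calc ‖antideriv v z‖ ≤ √(2 * π) * ‖v‖ + √(2 * π) * ‖v‖ :=
        (norm_sub_le _ _).trans (add_le_add (h z hz) h3)
    _ = _ := by ring

/-- Evaluation of the antiderivative at a point of the period, as a bounded functional. -/
def antiderivAt (z : ℝ) (hz : z ∈ Icc (-π) π) : L2per →L[ℂ] ℂ :=
  LinearMap.mkContinuous
    { toFun := fun v => antideriv v z
      map_add' := fun v w => antideriv_add v w hz
      map_smul' := fun a v => antideriv_smul a v hz }
    (2 * √(2 * π)) fun v => norm_antideriv_le v hz

/-- The antiderivative as a bounded operator on periodic `L²` functions. -/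
def antiderivL : L2per →L[ℂ] L2per :=
  LinearMap.mkContinuous
    { toFun := fun v => (memLp_antideriv v).toLp (antideriv v)
      map_add' := by
        intro v w
        apply Lp.ext
        filter_upwards [(memLp_antideriv (v + w)).coeFn_toLp, (memLp_antideriv v).coeFn_toLp,
          (memLp_antideriv w).coeFn_toLp, ae_restrict_mem measurableSet_Ioc,
          Lp.coeFn_add ((memLp_antideriv v).toLp (antideriv v))
            ((memLp_antideriv w).toLp (antideriv w))] with z h₁ h₂ h₃ hz h₄
        rw [h₁, h₄, Pi.add_apply, h₂, h₃, antideriv_add _ _ (Ioc_subset_Icc_self hz)]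
      map_smul' := by
        intro a v
        apply Lp.ext
        filter_upwards [(memLp_antideriv (a • v)).coeFn_toLp, (memLp_antideriv v).coeFn_toLp,
          ae_restrict_mem measurableSet_Ioc,
          Lp.coeFn_smul a ((memLp_antideriv v).toLp (antideriv v))] with z h₁ h₂ hz h₄
        simp only [RingHom.id_apply]
        rw [h₁, h₄, Pi.smul_apply, h₂, antideriv_smul _ _ (Ioc_subset_Icc_self hz), smul_eq_mul] }
    (measureUnivNNReal (volume.restrict (Ioc (-π) π)) ^ (2 : ENNReal).toReal⁻¹ *
      (2 * √(2 * π))) fun v => by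
      rw [mul_assoc]
      refine Lp.norm_le_of_ae_bound (by positivity) ?_
      filter_upwards [(memLp_antideriv v).coeFn_toLp, ae_restrict_mem measurableSet_Ioc] with z h hz
      change ‖((memLp_antideriv v).toLp (antideriv v) : ℝ → ℂ) z‖ ≤ _
      rw [h]
      exact norm_antideriv_le v (Ioc_subset_Icc_self hz)

lemma antiderivL_ae_eq (v : L2per) :
    (antiderivL v : ℝ → ℂ) =ᵐ[volume.restrict (Ioc (-π) π)] antideriv v :=
  (memLp_antideriv v).coeFn_toLp

/-- The nodes of the uniform partition of the period into `N + 1` cells. -/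
def node (N j : ℕ) : ℝ := -π + j * (2 * π / (N + 1))

lemma node_monotone (N : ℕ) : Monotone (node N) := by
  intro i j hij
  have := pi_pos
  have hij' : (i : ℝ) ≤ j := Nat.cast_le.2 hij
  unfold node
  gcongr

lemma node_zero (N : ℕ) : node N 0 = -π := by simp [node]

lemma node_last (N : ℕ) : node N (N + 1) = π := by
  unfold node
  push_cast
  field_simp
  ring

lemma node_mem {N j : ℕ} (hj : j ≤ N + 1) : node N j ∈ Icc (-π) π := by
  constructor
  · rw [← node_zero N]
    exact node_monotone N (Nat.zero_le j)
  · rw [← node_last N]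
    exact node_monotone N hj

/-- Finite-rank approximation of the antiderivative by step functions. -/
def stepAntideriv (N : ℕ) : L2per →L[ℂ] L2per :=
  ∑ j : Fin (N + 1), (antiderivAt (node N j) (node_mem j.2.le)).smulRight
    (indicatorConstLp 2 (measurableSet_Ioc (a := node N j) (b := node N (j + 1)))
      (measure_ne_top (volume.restrict (Ioc (-π) π)) _) (1 : ℂ))

lemma isCompactOperator_smulRight {X Y : Type*} [NormedAddCommGroup X] [NormedSpace ℂ X]
    [NormedAddCommGroup Y] [NormedSpace ℂ Y] (l : X →L[ℂ] ℂ) (y : Y) :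
    IsCompactOperator (l.smulRight y) := by
  have h : IsCompactOperator l := isCompactOperator_of_locallyCompactSpace_dom l
  exact h.clm_comp (ContinuousLinearMap.toSpanSingleton ℂ y)

lemma isCompactOperator_stepAntideriv (N : ℕ) : IsCompactOperator (stepAntideriv N) := by
  have h : stepAntideriv N ∈ compactOperator (RingHom.id ℂ) L2per L2per :=
    Submodule.sum_mem _ fun j _ => isCompactOperator_smulRight _ _
  exact h

lemma stepAntideriv_ae_eq (N : ℕ) (v : L2per) :
    ∀ᵐ z ∂volume.restrict (Ioc (-π) π), ∀ j : Fin (N + 1),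
      z ∈ Ioc (node N j) (node N (j + 1)) →
        (stepAntideriv N v : ℝ → ℂ) z = antideriv v (node N j) := by
  have e : stepAntideriv N v = ∑ j : Fin (N + 1), antideriv v (node N j) •
      indicatorConstLp 2 (measurableSet_Ioc (a := node N j) (b := node N (j + 1)))
        (measure_ne_top (volume.restrict (Ioc (-π) π)) _) (1 : ℂ) := by
    simp only [stepAntideriv, _root_.sum_apply, ContinuousLinearMap.smulRight_apply]
    rfl
  rw [e]
  have h1 : ∀ᵐ z ∂volume.restrict (Ioc (-π) π), ∀ j : Fin (N + 1),
      (antideriv v (node N j) •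
        indicatorConstLp 2 (measurableSet_Ioc (a := node N j) (b := node N (j + 1)))
          (measure_ne_top (volume.restrict (Ioc (-π) π)) _) (1 : ℂ) : L2per) z =
      antideriv v (node N j) *
        (Ioc (node N j) (node N (j + 1))).indicator (fun _ => (1 : ℂ)) z := by
    rw [ae_all_iff]
    intro j
    filter_upwards [Lp.coeFn_smul (antideriv v (node N j))
      (indicatorConstLp 2 (measurableSet_Ioc (a := node N j) (b := node N (j + 1)))
        (measure_ne_top (volume.restrict (Ioc (-π) π)) _) (1 : ℂ)),
      indicatorConstLp_coeFn (p := 2)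
        (hs := measurableSet_Ioc (a := node N j) (b := node N (j + 1)))
        (hμs := measure_ne_top (volume.restrict (Ioc (-π) π)) _) (c := (1 : ℂ))] with z h1 h2
    rw [h1, Pi.smul_apply, h2, smul_eq_mul]
  filter_upwards [h1, Lp.coeFn_finsetSum Finset.univ fun j : Fin (N + 1) =>
    antideriv v (node N j) •
      indicatorConstLp 2 (measurableSet_Ioc (a := node N j) (b := node N (j + 1)))
        (measure_ne_top (volume.restrict (Ioc (-π) π)) _) (1 : ℂ)] with z h1 h2 j hj
  rw [h2, Finset.sum_apply, Finset.sum_congr rfl fun i _ => h1 i, Finset.sum_eq_single j]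
  · rw [indicator_of_mem hj, mul_one]
  · intro i _ hij
    rw [indicator_of_notMem, mul_zero]
    intro hi
    have hne : (i : ℕ) ≠ j := fun h => hij (Fin.ext h)
    exact Set.disjoint_left.1 ((node_monotone N).pairwise_disjoint_on_Ioc_succ hne) hi hj
  · simp

lemma exists_mem_cell (N : ℕ) {z : ℝ} (hz : z ∈ Ioc (-π) π) :
    ∃ j : Fin (N + 1), z ∈ Ioc (node N j) (node N (j + 1)) := by
  have h := (node_monotone N).biUnion_Ico_Ioc_map_succ 0 (N + 1)
  rw [node_zero, node_last] at h
  rw [← h] at hz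
  simp only [mem_iUnion] at hz
  obtain ⟨j, hj, hz⟩ := hz
  exact ⟨⟨j, hj.2⟩, hz⟩

lemma norm_antiderivL_sub_step_le (N : ℕ) :
    ‖antiderivL - stepAntideriv N‖ ≤
      measureUnivNNReal (volume.restrict (Ioc (-π) π)) ^ (2 : ENNReal).toReal⁻¹ *
        √(2 * π / (N + 1)) := by
  refine ContinuousLinearMap.opNorm_le_bound _ (by positivity) fun v => ?_
  rw [mul_assoc]
  refine Lp.norm_le_of_ae_bound (by positivity) ?_
  rw [_root_.sub_apply]
  filter_upwards [stepAntideriv_ae_eq N v, antiderivL_ae_eq v, ae_restrict_mem measurableSet_Ioc,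
    Lp.coeFn_sub (antiderivL v) (stepAntideriv N v)] with z h1 h2 hz h3
  obtain ⟨j, hj⟩ := exists_mem_cell N hz
  rw [h3, Pi.sub_apply, h2, h1 j hj]
  refine (norm_antideriv_sub_le v (node_mem j.2.le).1 hj.1.le hz.2).trans ?_
  gcongr
  have := hj.2
  simp only [node] at this ⊢
  push_cast at this
  linarith

lemma isCompactOperator_antiderivL : IsCompactOperator antiderivL := by
  have h0 : Tendsto (fun N : ℕ =>
      (measureUnivNNReal (volume.restrict (Ioc (-π) π)) : ℝ) ^ (2 : ENNReal).toReal⁻¹ *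
        √(2 * π / (N + 1))) atTop (𝓝 0) := by
    have h1 : Tendsto (fun N : ℕ => 2 * π / ((N : ℝ) + 1)) atTop (𝓝 0) :=
      tendsto_const_nhds.div_atTop (tendsto_atTop_add_const_right _ _ tendsto_natCast_atTop_atTop)
    have h2 := (Real.continuous_sqrt.tendsto 0).comp h1
    rw [Real.sqrt_zero] at h2
    simpa using h2.const_mul
      ((measureUnivNNReal (volume.restrict (Ioc (-π) π)) : ℝ) ^ (2 : ENNReal).toReal⁻¹)
  have ht : Tendsto stepAntideriv atTop (𝓝 antiderivL) := by
    rw [tendsto_iff_norm_sub_tendsto_zero]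
    refine squeeze_zero (fun _ => norm_nonneg _) (fun N => ?_) h0
    rw [norm_sub_rev]
    exact norm_antiderivL_sub_step_le N
  exact isCompactOperator_of_tendsto ht
    (Eventually.of_forall fun N => isCompactOperator_stepAntideriv N)

lemma isClosed_dotL2per : IsClosed (dotL2per : Set L2per) := by
  let l : L2per →L[ℂ] ℂ := LinearMap.mkContinuous
    { toFun := fun v => ∫ z in (-π)..π, v z
      map_add' := fun v w => integral_add_L2per v w (right_mem_Icc.2 neg_pi_le_pi)
      map_smul' := fun a v => integral_smul_L2per a v (right_mem_Icc.2 neg_pi_le_pi) }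
    (√(π - -π)) fun v => norm_integral_L2per_le v le_rfl neg_pi_le_pi le_rfl
  have h : (dotL2per : Set L2per) = l ⁻¹' {0} := rfl
  rw [h]
  exact isClosed_singleton.preimage l.continuous

instance : CompleteSpace dotL2per := isClosed_dotL2per.completeSpace_coe

/-- `∂_z⁻¹` as a bounded operator on the mean-zero space. -/
def invDerivL : dotL2per →L[ℂ] dotL2per :=
  (antiderivL.comp dotL2per.subtypeL).codRestrict dotL2per fun v => (invDeriv v).2

lemma isCompactOperator_invDerivL : IsCompactOperator invDerivL :=
  (isCompactOperator_antiderivL.comp_clm dotL2per.subtypeL).codRestrict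
    (fun v => (invDeriv v).2) isClosed_dotL2per

/-! ### The spectrum -/

/-- Square-integrable functions on the two half-periods combine to one on the whole period. -/
lemma exists_L2per_of_halves {u₁ u₂ : ℝ → ℂ} (h₁ : MemLp u₁ 2 (volume.restrict (Ioc (-π) 0)))
    (h₂ : MemLp u₂ 2 (volume.restrict (Ioc 0 π))) :
    ∃ v : L2per, (v : ℝ → ℂ) =ᵐ[volume.restrict (Ioc (-π) 0)] u₁ ∧
      (v : ℝ → ℂ) =ᵐ[volume.restrict (Ioc 0 π)] u₂ := by
  classical
  have e₁ : (volume.restrict (Ioc (-π) π)).restrict (Iic 0) = volume.restrict (Ioc (-π) 0) := by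
    rw [Measure.restrict_restrict measurableSet_Iic, inter_comm, Ioc_inter_Iic,
      min_eq_right pi_pos.le]
  have e₂ : (volume.restrict (Ioc (-π) π)).restrict (Iic 0)ᶜ = volume.restrict (Ioc 0 π) := by
    rw [compl_Iic, Measure.restrict_restrict measurableSet_Ioi, inter_comm, Ioc_inter_Ioi,
      max_eq_right (neg_nonpos.2 pi_pos.le)]
  have hm : MemLp ((Iic (0 : ℝ)).piecewise u₁ u₂) 2 (volume.restrict (Ioc (-π) π)) :=
    MemLp.piecewise measurableSet_Iic (by rwa [e₁]) (by rwa [e₂])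
  refine ⟨hm.toLp _, ?_, ?_⟩
  · filter_upwards [ae_left_of_ae hm.coeFn_toLp, ae_restrict_mem measurableSet_Ioc] with z h hz
    rw [h, piecewise_eq_of_mem _ _ _ (mem_Iic.2 hz.2)]
  · filter_upwards [ae_right_of_ae hm.coeFn_toLp, ae_restrict_mem measurableSet_Ioc] with z h hz
    rw [h, piecewise_eq_of_notMem _ _ _ (notMem_Iic.2 hz.1)]

lemma peakedTransport_apply_eq {v g : dotL2per} (h : HasWeakDeriv (peakedFlux v) g)
    (hv : v ∈ peakedTransport.domain) : peakedTransport ⟨v, hv⟩ = g :=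
  fluxDeriv_eq 2 peakedSpeed peakedWave ⟨v, hv⟩ h

/-- The transport operator has no eigenvalues. -/
lemma peakedTransport_injective (c : ℂ) (v : peakedTransport.domain)
    (h : peakedTransport v - c • (v : dotL2per) = 0) : v = 0 := by
  have hw : HasWeakDeriv (peakedFlux (v : dotL2per)) (c • (v : dotL2per) : dotL2per) := by
    rw [← sub_eq_zero.1 h]
    exact fluxDeriv_spec 2 peakedSpeed peakedWave v
  obtain ⟨u, hu, hl, hr⟩ := exists_hasFluxDerivOn_of_hasWeakDeriv hw
  have hcu : ((c • (v : dotL2per) : dotL2per) : ℝ → ℂ) =ᵐ[volume.restrict (Ioc (-π) π)]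
      fun z => c * u z := by
    filter_upwards [Lp.coeFn_smul c ((v : dotL2per) : L2per), hu] with z h1 h2
    rw [Submodule.coe_smul, h1, Pi.smul_apply, h2, smul_eq_mul]
  have hum := (Lp.memLp ((v : dotL2per) : L2per)).ae_eq hu
  have hπ : -π < 0 := by linarith [pi_pos]
  have z1 := HasFluxDerivOn.eq_zero_of_eigen hπ (IsPrimitiveOn.congr_ae hl (ae_left_of_ae hcu))
    (intervalIntegrable_of_memLp_two hπ (hum.mono_measure restrict_left_le))
  have z2 := HasFluxDerivOn.eq_zero_of_eigen pi_pos (IsPrimitiveOn.congr_ae hr (ae_right_of_ae hcu))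
    (intervalIntegrable_of_memLp_two pi_pos (hum.mono_measure restrict_right_le))
  have hu0 : ∀ᵐ z ∂volume.restrict (Ioc (-π) π), u z = 0 := by
    refine ae_of_ae_left_right ?_ ?_
    · rw [← restrict_Ioo_eq_restrict_Ioc]
      filter_upwards [ae_restrict_mem measurableSet_Ioo] with z hz using z1 z hz
    · rw [← restrict_Ioo_eq_restrict_Ioc]
      filter_upwards [ae_restrict_mem measurableSet_Ioo] with z hz using z2 z hz
  apply Subtype.ext
  apply Subtype.ext
  apply Lp.ext
  filter_upwards [hu, hu0, Lp.coeFn_zero ℂ 2 (volume.restrict (Ioc (-π) π))] with z h1 h2 h3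
  rw [h1, h2]
  exact h3.symm

/-- Outside the closed strip the transport operator is boundedly invertible. -/
lemma mem_resolventSet_peakedTransport {c : ℂ} (hc : π / 4 < |c.re|) :
    c ∈ resolventSet peakedTransport := by
  refine ⟨peakedTransport_injective c, fun f => ?_, (|c.re| - π / 4)⁻¹, fun v => ?_⟩
  · have hf := Lp.memLp (f : L2per)
    obtain ⟨u₁, hu₁, hl⟩ := exists_hasFluxDerivOn (a := -π) (b := 0) (by linarith [pi_pos])
      (c := c) (by simpa using hc) (hf.mono_measure restrict_left_le)
    obtain ⟨u₂, hu₂, hr⟩ := exists_hasFluxDerivOn pi_pos (c := c) (by simpa using hc)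
      (hf.mono_measure restrict_right_le)
    obtain ⟨v, hv₁, hv₂⟩ := exists_L2per_of_halves hu₁ hu₂
    have hg : ((f + c • v : L2per) : ℝ → ℂ) =ᵐ[volume.restrict (Ioc (-π) π)]
        fun z => (f : L2per) z + c * v z := by
      filter_upwards [Lp.coeFn_add (f : L2per) (c • v), Lp.coeFn_smul c v] with z h1 h2
      rw [h1, Pi.add_apply, h2, Pi.smul_apply, smul_eq_mul]
    have hw : HasWeakDeriv (peakedFlux v) (f + c • v : L2per) := by
      refine hasWeakDeriv_of_hasFluxDerivOn hv₁ hv₂ (Lp.memLp _) (IsPrimitiveOn.congr_ae hl ?_)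
        (IsPrimitiveOn.congr_ae hr ?_)
      · filter_upwards [ae_left_of_ae hg, hv₁] with z h1 h2
        rw [h1, h2]
      · filter_upwards [ae_right_of_ae hg, hv₂] with z h1 h2
        rw [h1, h2]
    have hc0 : c ≠ 0 := by
      rintro rfl
      rw [Complex.zero_re, abs_zero] at hc
      linarith [pi_pos]
    -- the flux has mean zero, hence so does `v = (g - f)/c`
    have hmean : ∫ z in (-π)..π, v z = 0 := by
      have h0 := hw.integral_eq_zero
      have hf0 : ∫ z in (-π)..π, (f : L2per) z = 0 := f.2
      rw [integral_add_L2per _ _ (right_mem_Icc.2 neg_pi_le_pi),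
        integral_smul_L2per _ _ (right_mem_Icc.2 neg_pi_le_pi), hf0, zero_add] at h0
      exact (mul_eq_zero.1 h0).resolve_left hc0
    let w : dotL2per := ⟨v, hmean⟩
    have hw' : HasWeakDeriv (peakedFlux w) (f + c • w : dotL2per) := hw
    have hdom : w ∈ peakedTransport.domain := ⟨_, hw'⟩
    refine ⟨⟨w, hdom⟩, ?_⟩
    rw [peakedTransport_apply_eq hw' hdom]
    exact add_sub_cancel_right f (c • w)
  · have h := sub_mul_norm_le_of_abs_re_inner_le (c := c) (abs_re_inner_peakedTransport_le v)
    rw [inv_mul_eq_div, le_div_iff₀ (sub_pos.2 hc), mul_comm]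
    exact h

/-- In the open strip the transport operator has residual spectrum: its shifted range is
annihilated by `e^{-c τ}` on `(0, π)`, with `τ` the travel time. -/
lemma notMem_resolventSet_peakedTransport {c : ℂ} (hc : |c.re| < π / 4) :
    c ∉ resolventSet peakedTransport := by
  rintro ⟨-, hsurj, -⟩
  set e : ℝ → ℂ := fun z => Complex.exp (-c * travelTime 0 π z) with he
  have hem : MemLp e 2 (volume.restrict (Ioc 0 π)) :=
    memLp_cexp_travelTime pi_pos (by simpa using hc)
  have hei := intervalIntegrable_of_memLp_two pi_pos (memLp_two_conj hem)
  -- `f = ē` on `(0, π)` pairs nontrivially with `e`; a constant on `(-π, 0)` makes it mean-zero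
  set κ : ℂ := ((1 / π : ℝ) : ℂ) * ∫ z in (0 : ℝ)..π, conj (e z) with hκ
  obtain ⟨f, hf₁, hf₂⟩ := exists_L2per_of_halves (memLp_const (-κ)) (memLp_two_conj hem)
  have hf0 : ∫ z in (-π)..π, f z = 0 := by
    rw [← intervalIntegral_split (intervalIntegrable_L2per f)]
    have h1 : ∫ z in (-π)..0, f z = -∫ z in (0 : ℝ)..π, conj (e z) := by
      have : ∫ z in (-π)..0, f z = ∫ _ in (-π)..0, -κ := by
        refine intervalIntegral.integral_congr_ae_restrict ?_
        rwa [uIoc_of_le (by linarith [pi_pos])]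
      rw [this, intervalIntegral.integral_const, hκ, smul_neg, Complex.real_smul, ← mul_assoc,
        ← Complex.ofReal_mul]
      have : (0 - -π) * (1 / π) = 1 := by
        have := pi_pos.ne'
        field_simp
        ring
      rw [this]
      simp
    have h2 : ∫ z in (0 : ℝ)..π, f z = ∫ z in (0 : ℝ)..π, conj (e z) := by
      refine intervalIntegral.integral_congr_ae_restrict ?_
      rwa [uIoc_of_le pi_pos.le]
    rw [h1, h2]
    ring
  obtain ⟨v, hv⟩ := hsurj ⟨f, hf0⟩
  have hspec := fluxDeriv_spec 2 peakedSpeed peakedWave v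
  have hval : fluxDeriv 2 peakedSpeed peakedWave v = ⟨f, hf0⟩ + c • (v : dotL2per) :=
    sub_eq_iff_eq_add.1 hv
  rw [hval] at hspec
  obtain ⟨u, hu, -, hr⟩ := exists_hasFluxDerivOn_of_hasWeakDeriv hspec
  have hg : (((⟨f, hf0⟩ + c • (v : dotL2per) : dotL2per) : L2per) : ℝ → ℂ)
      =ᵐ[volume.restrict (Ioc (-π) π)] fun z => f z + c * u z := by
    filter_upwards [Lp.coeFn_add f (c • ((v : dotL2per) : L2per)),
      Lp.coeFn_smul c ((v : dotL2per) : L2per), hu] with z h1 h2 h3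
    rw [Submodule.coe_add, Submodule.coe_smul, h1, Pi.add_apply, h2, Pi.smul_apply, h3,
      smul_eq_mul]
  have hum := ((Lp.memLp ((v : dotL2per) : L2per)).ae_eq hu).mono_measure restrict_right_le
  have h0 := HasFluxDerivOn.integral_mul_cexp_eq_zero pi_pos (c := c) (by simpa using hc)
    (IsPrimitiveOn.congr_ae hr (ae_right_of_ae hg)) hum
    ((Lp.memLp f).mono_measure restrict_right_le)
  have h1 : ∫ z in (0 : ℝ)..π, f z * Complex.exp (-c * travelTime 0 π z) =
      ((∫ z in (0 : ℝ)..π, ‖e z‖ ^ 2 : ℝ) : ℂ) := by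
    rw [← intervalIntegral.integral_ofReal]
    refine intervalIntegral.integral_congr_ae_restrict ?_
    rw [uIoc_of_le pi_pos.le]
    filter_upwards [hf₂] with z hz
    rw [hz, Complex.conj_mul']
    push_cast
    rfl
  rw [h1] at h0
  have h2 : IntervalIntegrable (fun z => ‖e z‖ ^ 2) volume 0 π :=
    (intervalIntegrable_iff_integrableOn_Ioc_of_le pi_pos.le).2
      (hem.integrable_norm_pow (by norm_num))
  have h3 := intervalIntegral.intervalIntegral_pos_of_pos h2
    (fun z => pow_pos (norm_pos_iff.2 (Complex.exp_ne_zero _)) 2) pi_pos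
  exact h3.ne' (Complex.ofReal_eq_zero.1 h0)

lemma peakedLinearization_apply (v : dotL2per) (h : v ∈ peakedTransport.domain)
    (h' : v ∈ peakedLinearization.domain) :
    peakedLinearization ⟨v, h'⟩ = peakedTransport ⟨v, h⟩ + invDerivL v := rfl

lemma mem_resolventSet_peakedLinearization {c : ℂ} (hc : π / 4 < |c.re|) :
    c ∈ resolventSet peakedLinearization := by
  refine mem_resolventSet_of_compact_perturbation (mem_resolventSet_peakedTransport hc) invDerivL
    isCompactOperator_invDerivL rfl peakedLinearization_apply fun v hv => ?_
  exact Subtype.ext (eq_zero_of_sub_smul_eq_zero hc (abs_re_inner_peakedLinearization_le v) hv)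

lemma notMem_resolventSet_peakedLinearization {c : ℂ} (hc : |c.re| < π / 4) :
    c ∉ resolventSet peakedLinearization := by
  intro h
  refine notMem_resolventSet_peakedTransport hc ?_
  refine mem_resolventSet_of_compact_perturbation h (-invDerivL) isCompactOperator_invDerivL.neg
    rfl (fun v h₁ h₂ => ?_) (peakedTransport_injective c)
  rw [peakedLinearization_apply v h₂ h₁]
  simp

lemma spectrum_peakedLinearization :
    spectrum peakedLinearization = {z : ℂ | -(π / 4) ≤ z.re ∧ z.re ≤ π / 4} := by
  ext c
  rw [mem_ofPred_eq, ← abs_le]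
  constructor
  · intro h
    by_contra hc
    exact h (mem_resolventSet_peakedLinearization (not_le.1 hc))
  · intro hc h
    -- `(1 - t) c` lies in the open strip for small `t > 0` and tends to `c` as `t → 0`
    have hcont : Continuous fun t : ℝ => ((1 - t : ℝ) : ℂ) * c := by fun_prop
    have hnhds : ∀ᶠ t : ℝ in 𝓝[>] 0, ((1 - t : ℝ) : ℂ) * c ∈ resolventSet peakedLinearization := by
      refine Filter.Eventually.filter_mono nhdsWithin_le_nhds ?_
      refine hcont.continuousAt.eventually_mem
        ((isOpen_resolventSet peakedLinearization).mem_nhds ?_)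
      simpa using h
    obtain ⟨t, ht, ht0, ht1⟩ := (hnhds.and (Ioo_mem_nhdsGT one_pos)).exists
    refine notMem_resolventSet_peakedLinearization ?_ ht
    rw [Complex.re_ofReal_mul, abs_mul, abs_of_pos (sub_pos.2 ht1)]
    have := pi_pos
    nlinarith [abs_nonneg c.re]

end Ostrovsky

end

theorem theorem2p2 :
    Ostrovsky.spectrum
        (Ostrovsky.linearizedOperator 2 Ostrovsky.peakedSpeed Ostrovsky.peakedWave) =
      {z : ℂ | -(Real.pi / 4) ≤ z.re ∧ z.re ≤ Real.pi / 4} ∧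
    Ostrovsky.SpectrallyUnstable 2 Ostrovsky.peakedSpeed Ostrovsky.peakedWave := by
  refine ⟨Ostrovsky.spectrum_peakedLinearization, fun h => ?_⟩
  have hmem : ((Real.pi / 4 : ℝ) : ℂ) ∈ Ostrovsky.spectrum
      (Ostrovsky.linearizedOperator 2 Ostrovsky.peakedSpeed Ostrovsky.peakedWave) := by
    rw [Ostrovsky.spectrum_peakedLinearization, Set.mem_ofPred_eq, Complex.ofReal_re]
    constructor <;> linarith [Real.pi_pos]
  have h0 := h hmem
  rw [Set.mem_ofPred_eq, Complex.ofReal_re] at h0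
  linarith [Real.pi_pos]
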